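/- **Theorem 4.1.** Let $T>0$, $\mu_0>0$, and let $\Gamma(t)$, $t\in[0,T]$, be a two-dimensional closed (compact, without boundary), connected, oriented surface in $\mathbb{R}^3$ that is smooth and moves smoothly in time, with unit (outward) normal field $\nu(\cdot,t)$ and scalar normal velocity $V_\Gamma^N(\cdot,t)$ in the direction of $\nu$. Put $S_T=\bigcup_{t\in(0,T)}\Gamma(t)\times\{t\}$. Let $\pi(\cdot,t)$ be the closest point mapping onto $\Gamma(t)$ and $d(\cdot,t)$ the signed distance from $\Gamma(t)$ increasing in the direction of $\nu$, both defined near $\Gamma(t)$. For $\varepsilon>0$ let $\Omega_\varepsilon(t)=\{x\in\mathbb{R}^3 \mid \mathrm{dist}(x,\Gamma(t))<\varepsilon\}$, and let $\nu_\varepsilon$ and $V_\varepsilon^N$ be the unit outward normal and the scalar outward normal velocity of $\partial\Omega_\varepsilon(t)$. For all sufficiently small $\varepsilon>0$ let $u=u^\varepsilon$, $p=p^\varepsilon$ be a classical solution, regular up to the boundary, of $$\partial_tu+(u\cdot\nabla)u+\nabla p=\mu_0\Delta u,\qquad \mathrm{div}\,u=0\qquad\text{in }\Omega_\varepsilon(t),\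 t\in(0,T),$$ $$u\cdot\nu_\varepsilon=V_\varepsilon^N,\qquad (I_3-\nu_\varepsilon\otimes\nu_\varepsilon)D(u)\nu_\varepsilon=0\qquad\text{on }\partial\Omega_\varepsilon(t),\ t\in(0,T),$$ where $(\nabla u)_{ij}=\partial_iu_j$ and $D(u)=\frac12\{\nabla u+(\nabla u)^T\}$. Suppose that there are smooth functions $v,v^1,v^2\colon S_T\to\mathbb{R}^3$ and $q,q^1\colon S_T\to\mathbb{R}$, independent of $\varepsilon$, such that in $\Omega_\varepsilon(t)$ $$u(x,t)=v(\pi,t)+d\,v^1(\pi,t)+d^2v^2(\pi,t)+R(d^3),\qquad p(x,t)=q(\pi,t)+d\,q^1(\pi,t)+R(d^2),$$ where $\pi=\pi(x,t)$, $d=d(x,t)$, and $R(d^k)$ stands for a remainder whose space-time derivatives of each order $l<k$ are, at each fixed time $t\in(0,T)$, bounded on $\Omega_\varepsilon(t)$ by $C\varepsilon^{k-l}$ for all small $\varepsilon$, with $C$ independent of $\varepsilon$ and of $x$. Then $v\cdot\nu=V_\Gamma^N$ on $S_T$, and $$\partial^\bullet_vv+\nabla_\Gamma q+q^1\nu=2\mu_0\,\mathrm{div}_\Gamma\bigl(P_\Gamma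 D^{tan}(v)P_\Gamma\bigr),\qquad \mathrm{div}_\Gamma v=0\qquad\text{on }S_T.$$ Here, for functions on $S_T$ and arbitrary smooth extensions $\tilde f$ of them to a neighbourhood, $P_\Gamma=I_3-\nu\otimes\nu$, $\nabla_\Gamma f=P_\Gamma\nabla\tilde f=(\partial_1^{tan}f,\partial_2^{tan}f,\partial_3^{tan}f)$, $(\nabla_\Gamma v)_{ij}=\partial_i^{tan}v_j$, $D^{tan}(v)=\frac12\{\nabla_\Gamma v+(\nabla_\Gamma v)^T\}$, $\mathrm{div}_\Gamma v=\sum_i\partial_i^{tan}v_i$, $[\mathrm{div}_\Gamma M]_j=\sum_i\partial_i^{tan}M_{ij}$ for a matrix field $M$, and $\partial^\bullet_vf=\partial_t\tilde f+v\cdot\nabla\tilde f$ is the material derivative along $v$. -/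

import Mathlib

open Set Filter Topology
open scoped ContDiff Matrix

noncomputable section

namespace ThinNS

/-- Three-dimensional Euclidean space. -/
abbrev E3 := EuclideanSpace ℝ (Fin 3)

/-! ### Differential operators on space-time `ℝ³ × ℝ` -/

/-- The partial derivative `∂ᵢ f` of a function of `(x, t)`. -/
def dx {F : Type*} [NormedAddCommGroup F] [NormedSpace ℝ F]
    (i : Fin 3) (f : E3 × ℝ → F) (z : E3 × ℝ) : F :=
  fderiv ℝ f z (EuclideanSpace.single i 1, 0)

/-- The partial derivative `∂ₜ f` of a function of `(x, t)`. -/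
def dt {F : Type*} [NormedAddCommGroup F] [NormedSpace ℝ F]
    (f : E3 × ℝ → F) (z : E3 × ℝ) : F :=
  fderiv ℝ f z (0, 1)

/-- The spatial gradient `∇ f` of a scalar function. -/
def grad (f : E3 × ℝ → ℝ) (z : E3 × ℝ) : E3 :=
  WithLp.toLp 2 fun i => dx i f z

/-- The spatial gradient matrix `∇ F = (∂ᵢ Fⱼ)ᵢⱼ` of a vector field. -/
def gradMat (F : E3 × ℝ → E3) (z : E3 × ℝ) : Matrix (Fin 3) (Fin 3) ℝ :=
  Matrix.of fun i j => dx i (fun w => F w j) z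

/-- The strain rate tensor `D(u) = (∇ u + (∇ u)ᵀ) / 2`. -/
def strain (u : E3 × ℝ → E3) (z : E3 × ℝ) : Matrix (Fin 3) (Fin 3) ℝ :=
  (1 / 2 : ℝ) • (gradMat u z + (gradMat u z)ᵀ)

/-! ### Moving surfaces and moving domains -/

/-- `Γ(t)`, `t ∈ [0, T]`, is a smoothly moving closed connected surface in `ℝ³`, with continuous
unit normal field `ν` and scalar normal velocity `V` in the direction of `ν`. Near each of its
points, the space-time track of `Γ` is the zero set of a smooth function `φ` with nonvanishing
spatial gradient, and there `ν = ∇φ / |∇φ|` and `V = -∂ₜφ / |∇φ|`. -/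
structure IsMovingClosedSurface (T : ℝ) (Γ : ℝ → Set E3) (ν : E3 × ℝ → E3) (V : E3 × ℝ → ℝ) :
    Prop where
  isCompact : IsCompact {z : E3 × ℝ | z.2 ∈ Icc 0 T ∧ z.1 ∈ Γ z.2}
  isConnected : ∀ t ∈ Icc 0 T, IsConnected (Γ t)
  exists_levelSet : ∀ t ∈ Icc 0 T, ∀ y ∈ Γ t, ∃ (U : Set (E3 × ℝ)) (φ : E3 × ℝ → ℝ),
    IsOpen U ∧ (y, t) ∈ U ∧ ContDiffOn ℝ ∞ φ U ∧ (∀ z ∈ U, grad φ z ≠ 0) ∧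
    (∀ z ∈ U, z.2 ∈ Icc 0 T → (z.1 ∈ Γ z.2 ↔ φ z = 0)) ∧
    (∀ z ∈ U, z.2 ∈ Icc 0 T → z.1 ∈ Γ z.2 →
      ν z = ‖grad φ z‖⁻¹ • grad φ z ∧ V z = -dt φ z / ‖grad φ z‖)

/-- The space-time surface `S_T = ⋃_{t ∈ (0, T)} Γ(t) × {t}`. -/
def spaceTimeSurface (T : ℝ) (Γ : ℝ → Set E3) : Set (E3 × ℝ) :=
  {z | z.2 ∈ Ioo 0 T ∧ z.1 ∈ Γ z.2}

/-- The moving thin domain `Ω_ε(t)`: the points at distance less than `ε` from `Γ(t)`. -/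
def thinDomain (Γ : ℝ → Set E3) (ε t : ℝ) : Set E3 :=
  Metric.thickening ε (Γ t)

/-- At the boundary point `z = (x, t)`, the moving domain `Ω` has unit outward normal `n` and
scalar outward normal velocity `w`: near `z` it is the set `φ < 0` for a smooth `φ` with `φ z = 0`
and nonvanishing spatial gradient, `n = ∇φ / |∇φ|` and `w = -∂ₜφ / |∇φ|`. -/
def HasOutwardNormal (Ω : ℝ → Set E3) (z : E3 × ℝ) (n : E3) (w : ℝ) : Prop :=
  ∃ φ : E3 × ℝ → ℝ, ContDiffAt ℝ ∞ φ z ∧ φ z = 0 ∧ grad φ z ≠ 0 ∧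
    (∀ᶠ y in 𝓝 z, (y.1 ∈ Ω y.2 ↔ φ y < 0)) ∧
    n = ‖grad φ z‖⁻¹ • grad φ z ∧ w = -dt φ z / ‖grad φ z‖

/-- A closest point to `x` in `A`. -/
def closestPoint (A : Set E3) (x : E3) : E3 :=
  Classical.epsilon fun y => y ∈ A ∧ dist x y = Metric.infDist x A

theorem closestPoint_of_mem {A : Set E3} {x : E3} (hx : x ∈ A) : closestPoint A x = x := by
  have h : ∃ y, y ∈ A ∧ dist x y = Metric.infDist x A :=
    ⟨x, hx, by rw [dist_self, Metric.infDist_zero_of_mem hx]⟩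
  have h2 : dist x (closestPoint A x) = Metric.infDist x A := (Classical.epsilon_spec h).2
  exact (dist_eq_zero.mp (h2.trans (Metric.infDist_zero_of_mem hx))).symm

/-- The extension `f(π(x, t), t)` of a function `f` on the space-time surface that is constant in
the normal direction, where `π(·, t)` is the closest point mapping onto `Γ(t)`. -/
def normalExt {F : Type*} (Γ : ℝ → Set E3) (f : E3 × ℝ → F) (z : E3 × ℝ) : F :=
  f (closestPoint (Γ z.2) z.1, z.2)

/-- The signed distance `d(x, t)` from `Γ(t)`, increasing in the direction of `ν`. -/
def signedDist (Γ : ℝ → Set E3) (ν : E3 × ℝ → E3) (z : E3 × ℝ) : ℝ :=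
  Real.sign (inner ℝ (z.1 - closestPoint (Γ z.2) z.1) (normalExt Γ ν z)) *
    Metric.infDist z.1 (Γ z.2)

/-- A function on the space-time surface `S_T` is smooth if it is locally the restriction of a
smooth function of `(x, t)`. -/
def SmoothOnSurface {F : Type*} [NormedAddCommGroup F] [NormedSpace ℝ F]
    (T : ℝ) (Γ : ℝ → Set E3) (f : E3 × ℝ → F) : Prop :=
  ∀ z ∈ spaceTimeSurface T Γ, ∃ g : E3 × ℝ → F, ContDiffAt ℝ ∞ g z ∧
    ∀ᶠ w in 𝓝[spaceTimeSurface T Γ] z, g w = f w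

/-! ### Tangential operators on the moving surface -/

/-- The orthogonal projection `P_Γ = I - ν ⊗ ν` onto the tangent plane. -/
def proj (ν : E3 × ℝ → E3) (z : E3 × ℝ) : Matrix (Fin 3) (Fin 3) ℝ :=
  1 - Matrix.vecMulVec (ν z).ofLp (ν z).ofLp

/-- The tangential derivative `∂ᵢᵗᵃⁿ f = ∑ⱼ (δᵢⱼ - νᵢ νⱼ) ∂ⱼ f̄`, computed with the constant normal
extension `f̄` of `f` (it does not depend on the extension). -/
def tanD (Γ : ℝ → Set E3) (ν : E3 × ℝ → E3) (i : Fin 3) (f : E3 × ℝ → ℝ) (z : E3 × ℝ) : ℝ :=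
  ∑ j, proj ν z i j * dx j (normalExt Γ f) z

/-- The tangential gradient matrix `∇_Γ G = (∂ᵢᵗᵃⁿ Gⱼ)ᵢⱼ`. -/
def surfGradMat (Γ : ℝ → Set E3) (ν : E3 × ℝ → E3) (G : E3 × ℝ → E3) (z : E3 × ℝ) :
    Matrix (Fin 3) (Fin 3) ℝ :=
  Matrix.of fun i j => tanD Γ ν i (fun w => G w j) z

/-- The surface divergence `div_Γ G = ∑ᵢ ∂ᵢᵗᵃⁿ Gᵢ` of a vector field. -/
def surfDiv (Γ : ℝ → Set E3) (ν : E3 × ℝ → E3) (G : E3 × ℝ → E3) (z : E3 × ℝ) : ℝ :=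
  ∑ i, tanD Γ ν i (fun w => G w i) z

/-- The `j`-th component `∑ᵢ ∂ᵢᵗᵃⁿ Mᵢⱼ` of the surface divergence of a matrix field. -/
def surfDivMat (Γ : ℝ → Set E3) (ν : E3 × ℝ → E3)
    (M : E3 × ℝ → Matrix (Fin 3) (Fin 3) ℝ) (j : Fin 3) (z : E3 × ℝ) : ℝ :=
  ∑ i, tanD Γ ν i (fun w => M w i j) z

/-- The tangential strain rate `Dᵗᵃⁿ(v) = (∇_Γ v + (∇_Γ v)ᵀ) / 2`. -/
def tanStrain (Γ : ℝ → Set E3) (ν : E3 × ℝ → E3) (v : E3 × ℝ → E3) (z : E3 × ℝ) :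
    Matrix (Fin 3) (Fin 3) ℝ :=
  (1 / 2 : ℝ) • (surfGradMat Γ ν v z + (surfGradMat Γ ν v z)ᵀ)

/-- The material derivative `∂•_v f = ∂ₜ f̄ + v · ∇ f̄` of a function `f` on the space-time surface,
computed with the constant normal extension `f̄` of `f`. The next theorem says that it is the
derivative of `f` along the trajectories of `v`. -/
def materialDeriv (Γ : ℝ → Set E3) (v : E3 × ℝ → E3) (f : E3 × ℝ → ℝ) (z : E3 × ℝ) : ℝ :=
  dt (normalExt Γ f) z + ∑ i, v z i * dx i (normalExt Γ f) z

theorem hasDerivAt_along_trajectory {Γ : ℝ → Set E3} {v : E3 × ℝ → E3} {f : E3 × ℝ → ℝ}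
    {γ : ℝ → E3} {t : ℝ} (hf : DifferentiableAt ℝ (normalExt Γ f) (γ t, t))
    (hΓ : ∀ᶠ s in 𝓝 t, γ s ∈ Γ s) (hγ : HasDerivAt γ (v (γ t, t)) t) :
    HasDerivAt (fun s => f (γ s, s)) (materialDeriv Γ v f (γ t, t)) t := by
  have h1 : HasDerivAt (fun s => normalExt Γ f (γ s, s))
      (fderiv ℝ (normalExt Γ f) (γ t, t) (v (γ t, t), 1)) t :=
    HasFDerivAt.comp_hasDerivAt (f := fun s => (γ s, s)) t hf.hasFDerivAt
      (hγ.prodMk (hasDerivAt_id t))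
  have h2 : (fun s => f (γ s, s)) =ᶠ[𝓝 t] fun s => normalExt Γ f (γ s, s) := by
    filter_upwards [hΓ] with s hs
    simp only [normalExt, closestPoint_of_mem hs]
  have h3 : ((v (γ t, t), 1) : E3 × ℝ) =
      (0, 1) + ∑ i, v (γ t, t) i • ((EuclideanSpace.single i 1, 0) : E3 × ℝ) := by
    refine Prod.ext ?_ ?_
    · ext j
      simp [Prod.fst_sum, Pi.single_apply]
    · simp [Prod.snd_sum]
  have h4 : fderiv ℝ (normalExt Γ f) (γ t, t) (v (γ t, t), 1) =
      materialDeriv Γ v f (γ t, t) := by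
    rw [h3, map_add, map_sum]
    simp only [map_smul, smul_eq_mul, materialDeriv, dt, dx]
  rw [← h4]
  exact h1.congr_of_eventuallyEq h2

/-! ### The Navier-Stokes equations in the thin domain and expansions in the signed distance -/

/-- `u`, `p` is a classical solution (regular up to the lateral boundary) of the incompressible
Navier-Stokes equations with viscosity `μ₀` and perfect slip Navier boundary conditions in the
moving domain `Ω(t)`, `t ∈ (0, T)`. -/
structure IsNavierStokesSolution (μ₀ T : ℝ) (Ω : ℝ → Set E3) (u : E3 × ℝ → E3) (p : E3 × ℝ → ℝ) :
    Prop where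
  contDiffAt_velocity : ∀ t ∈ Ioo 0 T, ∀ x ∈ closure (Ω t), ContDiffAt ℝ 2 u (x, t)
  contDiffAt_pressure : ∀ t ∈ Ioo 0 T, ∀ x ∈ closure (Ω t), ContDiffAt ℝ 1 p (x, t)
  momentum : ∀ t ∈ Ioo 0 T, ∀ x ∈ Ω t, ∀ j : Fin 3,
    dt (fun w => u w j) (x, t) + ∑ i, u (x, t) i * dx i (fun w => u w j) (x, t) + dx j p (x, t) =
      μ₀ * ∑ i, dx i (dx i fun w => u w j) (x, t)
  divergence_free : ∀ t ∈ Ioo 0 T, ∀ x ∈ Ω t, ∑ i, dx i (fun w => u w i) (x, t) = 0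
  boundary_normal : ∀ t ∈ Ioo 0 T, ∀ x ∈ frontier (Ω t), ∀ (n : E3) (w : ℝ),
    HasOutwardNormal Ω (x, t) n w → inner ℝ (u (x, t)) n = w
  boundary_tangential : ∀ t ∈ Ioo 0 T, ∀ x ∈ frontier (Ω t), ∀ (n : E3) (w : ℝ),
    HasOutwardNormal Ω (x, t) n w →
      (1 - Matrix.vecMulVec n.ofLp n.ofLp) *ᵥ (strain u (x, t) *ᵥ n.ofLp) = 0

/-- The family `R ε` of functions on the thin domains is a remainder of order `k`, written
`R(dᵏ)`: for each time, its space-time derivatives of order `l < k` are `O(ε^(k - l))` on the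
thin domain of width `ε`, as `ε → 0`. -/
def IsRemainder {F : Type*} [NormedAddCommGroup F] [NormedSpace ℝ F]
    (T : ℝ) (Γ : ℝ → Set E3) (k : ℕ) (R : ℝ → E3 × ℝ → F) : Prop :=
  ∀ t ∈ Ioo 0 T, ∃ C : ℝ, ∀ᶠ ε in 𝓝[>] (0 : ℝ), ∀ x ∈ closure (thinDomain Γ ε t),
    ∀ l < k, ‖iteratedFDeriv ℝ l (R ε) (x, t)‖ ≤ C * ε ^ (k - l)

end ThinNS

end

open ThinNS

noncomputable section

namespace ThinNS

/-! ### Spatial gradients -/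

/-! Write `W = v̄ + d v̄¹ + d² v̄²`, with bars for constant normal extensions. `W` is smooth near
the space-time surface, and `u - W` is `O(ε³)` there, its first derivatives `O(ε²)` and its second
derivatives `O(ε)`. So linear conditions on `u` pass to `W`, and the expansion order decides how
much survives.

Geometry: the inverse function theorem makes `π` smooth near the surface, and the differential of
`d` is `(h, k) ↦ ν̄ · h - V̄ k`. Hence, near the point `y + εν(y)`, `Ω_ε` is `d < ε`, with outward
normal `ν(y)` and normal velocity `V(y)` (`eventually_hasOutwardNormal`). Only this outer sheet of
the boundary is needed.

Boundary conditions: on the normal line `W` is the polynomial `v + r v¹ + r² v²`. Impermeability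
gives `(v·ν - V) + ε v¹·ν + ε² v²·ν = O(ε³)`, so all three coefficients vanish (`inner_normal_eq`).
Thus `W·ν` is constant along the normal line and `ν · D(W)ν = 0` there. The slip condition then
gives `D(W)ν = O(ε²)` at `y + εν`, so `D(W)ν` and its normal derivative vanish on the surface
(`strain_normal_eq_zero`).

Viscous term: by symmetry `D(W) = P D(W) P = P Dᵗᵃⁿ(v) P` on the surface, so `D(W)` is an extension
with which `div_Γ` can be computed. The vanishing normal derivative leaves the full divergence `½
(ΔW + ∇ div W)`, and `∇ div W = lim ∇ div u = 0` (`surfDivMat_eq`, `sum_dx_dx_expansion_eq_zero`).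

It remains to let `ε → 0` in the bulk equations at a point of the surface. The terms of `W` in `v¹`
contribute `v¹·ν` to the divergence and `(v·ν - V) v¹` to the acceleration, and both vanish. -/

theorem sum_smul_single (h : E3) : ∑ i, h i • EuclideanSpace.single i (1 : ℝ) = h := by
  ext j
  simp [Pi.single_apply]

theorem map_spatial_eq_sum {F : Type*} [NormedAddCommGroup F] [NormedSpace ℝ F]
    (L : E3 × ℝ →L[ℝ] F) (h : E3) :
    L (h, 0) = ∑ i, h i • L (EuclideanSpace.single i 1, 0) := by
  have : L.comp (ContinuousLinearMap.inl ℝ E3 ℝ) h =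
      ∑ i, h i • L.comp (ContinuousLinearMap.inl ℝ E3 ℝ) (EuclideanSpace.single i 1) := by
    conv_lhs => rw [← sum_smul_single h]
    rw [map_sum]
    simp only [map_smul]
  simpa using this

theorem fderiv_apply_spatial (φ : E3 × ℝ → ℝ) (z : E3 × ℝ) (h : E3) :
    fderiv ℝ φ z (h, 0) = inner ℝ (grad φ z) h := by
  rw [map_spatial_eq_sum]
  simp [grad, dx, PiLp.inner_apply]

theorem fderiv_apply_eq_inner_add (φ : E3 × ℝ → ℝ) (z : E3 × ℝ) (h : E3) (k : ℝ) :
    fderiv ℝ φ z (h, k) = inner ℝ (grad φ z) h + k * dt φ z := by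
  have : ((h, k) : E3 × ℝ) = (h, 0) + k • (0, 1) := by simp
  rw [this, map_add, map_smul, fderiv_apply_spatial, dt, smul_eq_mul]

theorem contDiffAt_grad {φ : E3 × ℝ → ℝ} {z : E3 × ℝ} (hφ : ContDiffAt ℝ ∞ φ z) :
    ContDiffAt ℝ ∞ (grad φ) z := by
  rw [contDiffAt_euclidean]
  intro i
  exact (hφ.fderiv_right (m := ∞) (by simp)).clm_apply contDiffAt_const

/-! ### Inverse function theorem and Lagrange multipliers -/

/-- In finite dimension an injective differential is invertible, and invertibility is an open
condition. Hence the inverse is smooth on a whole neighbourhood of `f a`, which is needed later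
because smoothness of `π` is required off the surface as well. -/
theorem exists_local_inverse {E : Type*} [NormedAddCommGroup E] [NormedSpace ℝ E]
    [FiniteDimensional ℝ E] {f : E → E} {a : E} (hf : ∀ᶠ x in 𝓝 a, ContDiffAt ℝ ∞ f x)
    (hinj : Function.Injective (fderiv ℝ f a)) :
    ∃ e : OpenPartialHomeomorph E E, a ∈ e.source ∧ ⇑e = f ∧
      ∀ᶠ y in 𝓝 (f a), y ∈ e.target ∧ ContDiffAt ℝ ∞ e.symm y := by
  have : CompleteSpace E := FiniteDimensional.complete ℝ E
  have hfa : ContDiffAt ℝ ∞ f a := hf.self_of_nhds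
  let f' : E ≃L[ℝ] E :=
    (LinearEquiv.ofInjectiveEndo (fderiv ℝ f a).toLinearMap hinj).toContinuousLinearEquiv
  have hf'eq : (f' : E →L[ℝ] E) = fderiv ℝ f a := by
    ext x
    rfl
  have hf' : HasFDerivAt f (f' : E →L[ℝ] E) a := by
    rw [hf'eq]
    exact (hfa.differentiableAt (by simp)).hasFDerivAt
  have hcont : ContinuousAt (fderiv ℝ f) a :=
    (hfa.fderiv_right (m := ∞) (by simp)).continuousAt
  have hev : ∀ᶠ x in 𝓝 a, fderiv ℝ f x ∈ range ((↑) : (E ≃L[ℝ] E) → E →L[ℝ] E) := by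
    apply hcont
    rw [← hf'eq]
    exact ContinuousLinearEquiv.nhds f'
  let e := hfa.toOpenPartialHomeomorph f hf' (by simp)
  have hcoe : ⇑e = f := hfa.toOpenPartialHomeomorph_coe hf' (by simp)
  have has : a ∈ e.source := hfa.mem_toOpenPartialHomeomorph_source hf' (by simp)
  refine ⟨e, has, hcoe, ?_⟩
  have hmem : f a ∈ e.target := hcoe ▸ e.map_source has
  have hsymm : e.symm (f a) = a := by rw [← hcoe]; exact e.left_inv has
  have htend : Tendsto e.symm (𝓝 (f a)) (𝓝 a) := by
    have := e.continuousAt_symm hmem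
    rwa [ContinuousAt, hsymm] at this
  filter_upwards [htend.eventually (hev.and hf), e.open_target.mem_nhds hmem] with y hy hyt
  obtain ⟨⟨g', hg'⟩, hfy⟩ := hy
  refine ⟨hyt, e.contDiffAt_symm (f₀' := g') hyt ?_ ?_⟩
  · rw [hcoe, hg']
    exact (hfy.differentiableAt (by simp)).hasFDerivAt
  · rwa [hcoe]

/-- If `y` is a point of the level set `ψ = ψ y` closest to `x`, then `x - y` is normal to it. -/
theorem sub_eq_smul_of_isLocalMinOn {E : Type*} [NormedAddCommGroup E] [InnerProductSpace ℝ E]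
    [CompleteSpace E] {ψ : E → ℝ} {x y g : E} (hψ : HasStrictFDerivAt ψ (innerSL ℝ g) y)
    (hg : g ≠ 0) (hmin : IsLocalMinOn (fun w => ‖x - w‖ ^ 2) {w | ψ w = ψ y} y) :
    x - y = (inner ℝ (x - y) g / ‖g‖ ^ 2) • g := by
  have h1 : HasStrictFDerivAt (fun w => ‖x - w‖ ^ 2)
      (2 • (innerSL ℝ (x - y)).comp (-ContinuousLinearMap.id ℝ E)) y :=
    (hasStrictFDerivAt_norm_sq (x - y)).comp y ((hasStrictFDerivAt_id y).const_sub x)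
  obtain ⟨a, b, hab, h⟩ :=
    IsLocalExtrOn.exists_multipliers_of_hasStrictFDerivAt_1d (Or.inl hmin) hψ h1
  have h2 : ∀ w, inner ℝ (a • g - (2 * b) • (x - y)) w = 0 := by
    intro w
    have := congrArg (fun L => L w) h
    simp only [add_apply, smul_apply,
      ContinuousLinearMap.comp_apply, neg_apply, innerSL_apply_apply,
      ContinuousLinearMap.id_apply, inner_neg_right, smul_eq_mul, nsmul_eq_mul,
      zero_apply] at this
    rw [inner_sub_left, real_inner_smul_left, real_inner_smul_left]
    push_cast at this
    linarith
  have h3 : a • g = (2 * b) • (x - y) := sub_eq_zero.mp (inner_self_eq_zero.mp (h2 _))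
  -- If `b = 0`, then `a g = 0` and `g ≠ 0` force both multipliers to vanish.
  have hb : b ≠ 0 := by
    rintro rfl
    have ha : a • g = 0 := by simpa using h3
    rcases smul_eq_zero.mp ha with rfl | h'
    · exact hab rfl
    · exact hg h'
  have h4 : x - y = (a / (2 * b)) • g := by
    rw [div_eq_inv_mul, mul_smul, h3, smul_smul, inv_mul_cancel₀ (by simpa using hb), one_smul]
  have hg2 : ‖g‖ ^ 2 ≠ 0 := by simpa using hg
  rw [h4, real_inner_smul_left, real_inner_self_eq_norm_sq, mul_div_assoc, div_self hg2, mul_one]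

/-! ### Time slices of a moving surface -/

theorem IsMovingClosedSurface.isCompact_slice {T : ℝ} {Γ : ℝ → Set E3} {ν : E3 × ℝ → E3}
    {V : E3 × ℝ → ℝ} (hΓ : IsMovingClosedSurface T Γ ν V) {t : ℝ} (ht : t ∈ Icc 0 T) :
    IsCompact (Γ t) := by
  have h : Γ t = Set.image Prod.fst ({z : E3 × ℝ | z.2 ∈ Icc 0 T ∧ z.1 ∈ Γ z.2} ∩ {z | z.2 = t}) := by
    ext x
    constructor
    · intro hx
      exact ⟨(x, t), ⟨⟨ht, hx⟩, rfl⟩, rfl⟩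
    · rintro ⟨⟨x', t'⟩, ⟨⟨_, h⟩, rfl⟩, rfl⟩
      exact h
  rw [h]
  exact (hΓ.isCompact.inter_right (isClosed_eq continuous_snd continuous_const)).image
    continuous_fst

theorem IsMovingClosedSurface.closestPoint_spec {T : ℝ} {Γ : ℝ → Set E3} {ν : E3 × ℝ → E3}
    {V : E3 × ℝ → ℝ} (hΓ : IsMovingClosedSurface T Γ ν V) {t : ℝ} (ht : t ∈ Icc 0 T) (x : E3) :
    closestPoint (Γ t) x ∈ Γ t ∧ dist x (closestPoint (Γ t) x) = Metric.infDist x (Γ t) := by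
  obtain ⟨y, hy, h⟩ :=
    (hΓ.isCompact_slice ht).exists_infDist_eq_dist (hΓ.isConnected t ht).nonempty x
  exact Classical.epsilon_spec (p := fun y => y ∈ Γ t ∧ dist x y = Metric.infDist x (Γ t))
    ⟨y, hy, h.symm⟩

/-! ### The tubular neighbourhood of a moving surface -/

/-- The map `(y, s, t) ↦ (y + s ∇φ(y, t), φ(y, t), t)`, whose inverse at `(x, 0, t)` gives the foot
of the normal to the level set of `φ(·, t)` through `x`. -/
def normalMap (φ : E3 × ℝ → ℝ) (a : E3 × ℝ × ℝ) : E3 × ℝ × ℝ :=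
  (a.1 + a.2.1 • grad φ (a.1, a.2.2), φ (a.1, a.2.2), a.2.2)

theorem contDiffAt_normalMap {φ : E3 × ℝ → ℝ} {a : E3 × ℝ × ℝ}
    (hφ : ContDiffAt ℝ ∞ φ (a.1, a.2.2)) : ContDiffAt ℝ ∞ (normalMap φ) a := by
  have hι : ContDiffAt ℝ ∞ (fun a : E3 × ℝ × ℝ => (a.1, a.2.2)) a := by fun_prop
  have h1 : ContDiffAt ℝ ∞ (fun a : E3 × ℝ × ℝ => φ (a.1, a.2.2)) a :=
    ContDiffAt.comp (g := φ) (f := fun a : E3 × ℝ × ℝ => (a.1, a.2.2)) a hφ hι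
  have h2 : ContDiffAt ℝ ∞ (fun a : E3 × ℝ × ℝ => grad φ (a.1, a.2.2)) a :=
    ContDiffAt.comp (g := grad φ) (f := fun a : E3 × ℝ × ℝ => (a.1, a.2.2)) a
      (contDiffAt_grad hφ) hι
  exact (contDiffAt_fst.add ((contDiffAt_fst.comp a contDiffAt_snd).smul h2)).prodMk
    (h1.prodMk (contDiffAt_snd.comp a contDiffAt_snd))

/-- At `s = 0` the second derivatives of `φ` drop out, and with `g = ∇φ` the differential is `(h, s,
k) ↦ (h + s g, g·h + k ∂ₜφ, k)`. A kernel vector has `k = 0` and `h = -s g`, hence `s |g|² = 0`. -/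
theorem injective_fderiv_normalMap {φ : E3 × ℝ → ℝ} {y : E3} {t : ℝ}
    (hφ : ContDiffAt ℝ ∞ φ (y, t)) (hg : grad φ (y, t) ≠ 0) :
    Function.Injective (fderiv ℝ (normalMap φ) (y, 0, t)) := by
  set a : E3 × ℝ × ℝ := (y, 0, t) with ha
  set ι : E3 × ℝ × ℝ →L[ℝ] E3 × ℝ := (ContinuousLinearMap.fst ℝ E3 (ℝ × ℝ)).prod
    ((ContinuousLinearMap.snd ℝ ℝ ℝ).comp (ContinuousLinearMap.snd ℝ E3 (ℝ × ℝ))) with hι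
  have hιd : HasFDerivAt (fun a : E3 × ℝ × ℝ => (a.1, a.2.2)) ι a := ι.hasFDerivAt
  have h1 : HasFDerivAt (fun a : E3 × ℝ × ℝ => φ (a.1, a.2.2)) ((fderiv ℝ φ (y, t)).comp ι) a :=
    HasFDerivAt.comp (g := φ) a (hφ.differentiableAt (by simp)).hasFDerivAt hιd
  have h2 : HasFDerivAt (fun a : E3 × ℝ × ℝ => grad φ (a.1, a.2.2))
      ((fderiv ℝ (grad φ) (y, t)).comp ι) a :=
    HasFDerivAt.comp (g := grad φ) a
      ((contDiffAt_grad hφ).differentiableAt (by simp)).hasFDerivAt hιd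
  have h3 : HasFDerivAt (fun a : E3 × ℝ × ℝ => a.2.1)
      ((ContinuousLinearMap.fst ℝ ℝ ℝ).comp (ContinuousLinearMap.snd ℝ E3 (ℝ × ℝ))) a :=
    ((ContinuousLinearMap.fst ℝ ℝ ℝ).comp (ContinuousLinearMap.snd ℝ E3 (ℝ × ℝ))).hasFDerivAt
  have h4 : HasFDerivAt (fun a : E3 × ℝ × ℝ => a.2.2)
      ((ContinuousLinearMap.snd ℝ ℝ ℝ).comp (ContinuousLinearMap.snd ℝ E3 (ℝ × ℝ))) a :=
    ((ContinuousLinearMap.snd ℝ ℝ ℝ).comp (ContinuousLinearMap.snd ℝ E3 (ℝ × ℝ))).hasFDerivAt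
  have h5 : HasFDerivAt (normalMap φ) _ a := (hasFDerivAt_fst.add (h3.smul h2)).prodMk (h1.prodMk h4)
  rw [h5.fderiv]
  rw [injective_iff_map_eq_zero]
  rintro ⟨h, s, k⟩ h0
  simp [hι, ha] at h0
  obtain ⟨e1, e2, e3⟩ := h0
  subst e3
  rw [fderiv_apply_spatial] at e2
  have e4 : h = -(s • grad φ (y, t)) := eq_neg_of_add_eq_zero_left e1
  rw [e4, inner_neg_right, real_inner_smul_right, real_inner_self_eq_norm_sq, neg_eq_zero] at e2
  have hs : s = 0 := by
    rcases mul_eq_zero.mp e2 with h | h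
    · exact h
    · exact absurd (by simpa using h) hg
  subst hs
  simp at e4
  simp [e4]

/-- The closest point mapping `π(x, t)` as a function on space-time. -/
def foot (Γ : ℝ → Set E3) (z : E3 × ℝ) : E3 := closestPoint (Γ z.2) z.1

/-- The properties of the closest point mapping and of the signed distance at a point `z` of a
tubular neighbourhood of the moving surface. -/
structure IsTubePoint (T : ℝ) (Γ : ℝ → Set E3) (ν : E3 × ℝ → E3) (V : E3 × ℝ → ℝ)
    (z : E3 × ℝ) : Prop where
  time_mem : z.2 ∈ Ioo 0 T
  foot_mem : foot Γ z ∈ Γ z.2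
  contDiffAt_foot : ContDiffAt ℝ ∞ (foot Γ) z
  contDiffAt_normal : ContDiffAt ℝ ∞ (normalExt Γ ν) z
  contDiffAt_signedDist : ContDiffAt ℝ ∞ (signedDist Γ ν) z
  infDist_eq : Metric.infDist z.1 (Γ z.2) = |signedDist Γ ν z|
  sub_foot : z.1 - foot Γ z = signedDist Γ ν z • normalExt Γ ν z
  norm_normal : ‖normalExt Γ ν z‖ = 1
  inner_fderiv_foot : ∀ h k,
    inner ℝ (normalExt Γ ν z) (fderiv ℝ (foot Γ) z (h, k)) = normalExt Γ V z * k

theorem spaceTimeSurface_time {T : ℝ} {Γ : ℝ → Set E3} {z : E3 × ℝ}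
    (hz : z ∈ spaceTimeSurface T Γ) : z.2 ∈ Icc 0 T := Ioo_subset_Icc_self hz.1

theorem eventually_time_mem {T : ℝ} {Γ : ℝ → Set E3} {z₀ : E3 × ℝ}
    (hz₀ : z₀ ∈ spaceTimeSurface T Γ) : ∀ᶠ z in 𝓝 z₀, z.2 ∈ Ioo 0 T :=
  continuous_snd.continuousAt.eventually (isOpen_Ioo.mem_nhds hz₀.1)

theorem foot_of_mem {T : ℝ} {Γ : ℝ → Set E3} {z : E3 × ℝ} (hz : z ∈ spaceTimeSurface T Γ) :
    foot Γ z = z.1 := closestPoint_of_mem hz.2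

theorem sign_mul_abs_self (r : ℝ) : Real.sign r * |r| = r := by
  rcases lt_trichotomy r 0 with h | rfl | h
  · rw [Real.sign_of_neg h, abs_of_neg h]
    ring
  · simp
  · rw [Real.sign_of_pos h, abs_of_pos h, one_mul]

/-- The closest point mapping is continuous at points of the surface near which the surface has
points at all nearby times. -/
theorem IsMovingClosedSurface.tendsto_foot {T : ℝ} {Γ : ℝ → Set E3} {ν : E3 × ℝ → E3}
    {V : E3 × ℝ → ℝ} (hΓ : IsMovingClosedSurface T Γ ν V) {z₀ : E3 × ℝ}
    (hz₀ : z₀ ∈ spaceTimeSurface T Γ) {y : E3 × ℝ → E3} (hy : Tendsto y (𝓝 z₀) (𝓝 z₀.1))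
    (hyΓ : ∀ᶠ z in 𝓝 z₀, y z ∈ Γ z.2) : Tendsto (foot Γ) (𝓝 z₀) (𝓝 z₀.1) := by
  rw [tendsto_iff_dist_tendsto_zero]
  have hx : Tendsto (fun z : E3 × ℝ => z.1) (𝓝 z₀) (𝓝 z₀.1) := continuous_fst.continuousAt
  have hlim : Tendsto (fun z : E3 × ℝ => dist z.1 (y z) + dist z.1 z₀.1) (𝓝 z₀) (𝓝 0) := by
    have := (hx.dist hy).add (hx.dist (tendsto_const_nhds (x := z₀.1)))
    simpa using this
  refine squeeze_zero' (Eventually.of_forall fun _ => dist_nonneg) ?_ hlim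
  filter_upwards [hyΓ, eventually_time_mem hz₀] with z hyz ht
  have h1 := (hΓ.closestPoint_spec (Ioo_subset_Icc_self ht) z.1).2
  have h2 : dist z.1 (foot Γ z) ≤ dist z.1 (y z) := by
    rw [foot, h1]
    exact Metric.infDist_le_dist_of_mem hyz
  calc dist (foot Γ z) z₀.1 ≤ dist (foot Γ z) z.1 + dist z.1 z₀.1 := dist_triangle _ _ _
    _ ≤ _ := by rw [dist_comm (foot Γ z)]; gcongr

/-- Near the foot, `Γ(t)` is the zero level of `φ(·, t)` and the foot minimises the distance to `x`
on it, so the Lagrange multiplier rule applies in the time slice. -/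
theorem IsMovingClosedSurface.sub_foot_eq_smul {T : ℝ} {Γ : ℝ → Set E3} {ν : E3 × ℝ → E3}
    {V : E3 × ℝ → ℝ} (hΓ : IsMovingClosedSurface T Γ ν V) {z : E3 × ℝ} (ht : z.2 ∈ Icc 0 T)
    {U : Set (E3 × ℝ)} {φ : E3 × ℝ → ℝ} (hU : IsOpen U) (hfU : (foot Γ z, z.2) ∈ U)
    (hφ : ContDiffAt ℝ ∞ φ (foot Γ z, z.2)) (hg : grad φ (foot Γ z, z.2) ≠ 0)
    (hlev : ∀ z ∈ U, z.2 ∈ Icc 0 T → (z.1 ∈ Γ z.2 ↔ φ z = 0)) :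
    z.1 - foot Γ z = (inner ℝ (z.1 - foot Γ z) (grad φ (foot Γ z, z.2)) /
      ‖grad φ (foot Γ z, z.2)‖ ^ 2) • grad φ (foot Γ z, z.2) := by
  have hspec := hΓ.closestPoint_spec ht z.1
  have hψ : HasStrictFDerivAt (fun w => φ (w, z.2)) (innerSL ℝ (grad φ (foot Γ z, z.2)))
      (foot Γ z) := by
    have h1 := hφ.hasStrictFDerivAt (by simp)
    have h2 : HasStrictFDerivAt (fun w : E3 => (w, z.2)) (ContinuousLinearMap.inl ℝ E3 ℝ)
        (foot Γ z) := (hasStrictFDerivAt_id _).prodMk (hasStrictFDerivAt_const _ _)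
    have h3 : innerSL ℝ (grad φ (foot Γ z, z.2)) =
        (fderiv ℝ φ (foot Γ z, z.2)).comp (ContinuousLinearMap.inl ℝ E3 ℝ) := by
      refine ContinuousLinearMap.ext fun w => ?_
      simp [fderiv_apply_spatial]
    rw [h3]
    exact HasStrictFDerivAt.comp (g := φ) (foot Γ z) h1 h2
  refine sub_eq_smul_of_isLocalMinOn hψ hg ?_
  have h0 : φ (foot Γ z, z.2) = 0 := (hlev _ hfU ht).mp hspec.1
  have hev : ∀ᶠ w in 𝓝 (foot Γ z), (w, z.2) ∈ U :=
    (by fun_prop : Continuous fun w : E3 => (w, z.2)).continuousAt.eventually (hU.mem_nhds hfU)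
  rw [IsLocalMinOn, IsMinFilter, eventually_nhdsWithin_iff]
  filter_upwards [hev] with w hw hwφ
  have hwΓ : w ∈ Γ z.2 := (hlev _ hw ht).mpr (hwφ.trans h0)
  have h3 : ‖z.1 - foot Γ z‖ ≤ ‖z.1 - w‖ := by
    rw [← dist_eq_norm, ← dist_eq_norm, foot, hspec.2]
    exact Metric.infDist_le_dist_of_mem hwΓ
  gcongr

/-- Near a point of the moving surface with level set function `φ`, the closest point mapping is
the first component of the inverse of `normalMap φ`. -/
theorem IsMovingClosedSurface.exists_eventuallyEq_foot {T : ℝ} {Γ : ℝ → Set E3}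
    {ν : E3 × ℝ → E3} {V : E3 × ℝ → ℝ} (hΓ : IsMovingClosedSurface T Γ ν V) {z₀ : E3 × ℝ}
    (hz₀ : z₀ ∈ spaceTimeSurface T Γ) {U : Set (E3 × ℝ)} {φ : E3 × ℝ → ℝ} (hU : IsOpen U)
    (hzU : z₀ ∈ U) (hφ : ContDiffOn ℝ ∞ φ U) (hg : ∀ z ∈ U, grad φ z ≠ 0)
    (hlev : ∀ z ∈ U, z.2 ∈ Icc 0 T → (z.1 ∈ Γ z.2 ↔ φ z = 0)) :
    ∃ s : E3 × ℝ → ℝ,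
      (∀ᶠ z in 𝓝 z₀, (foot Γ z, z.2) ∈ U ∧ ContDiffAt ℝ ∞ (foot Γ) z ∧ ContDiffAt ℝ ∞ s z ∧
        z.1 - foot Γ z = s z • grad φ (foot Γ z, z.2)) ∧
      ∀ᶠ r in 𝓝 (0 : ℝ), foot Γ (z₀.1 + r • grad φ z₀, z₀.2) = z₀.1 := by
  obtain ⟨y₀, t₀⟩ := z₀
  have hφat : ∀ z ∈ U, ContDiffAt ℝ ∞ φ z := fun z hz => hφ.contDiffAt (hU.mem_nhds hz)
  set a₀ : E3 × ℝ × ℝ := (y₀, 0, t₀) with ha₀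
  have hφ0 : φ (y₀, t₀) = 0 := (hlev _ hzU (spaceTimeSurface_time hz₀)).mp hz₀.2
  have hFa : normalMap φ a₀ = (y₀, 0, t₀) := by simp [normalMap, ha₀, hφ0]
  have hev : ∀ᶠ a in 𝓝 a₀, ContDiffAt ℝ ∞ (normalMap φ) a := by
    have : ∀ᶠ a : E3 × ℝ × ℝ in 𝓝 a₀, (a.1, a.2.2) ∈ U :=
      (by fun_prop : Continuous fun a : E3 × ℝ × ℝ => (a.1, a.2.2)).continuousAt.eventually
        (hU.mem_nhds hzU)
    filter_upwards [this] with a ha using contDiffAt_normalMap (hφat _ ha)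
  obtain ⟨e, hsrc, hcoe, hsymm⟩ := exists_local_inverse hev
    (injective_fderiv_normalMap (hφat _ hzU) (hg _ hzU))
  rw [hFa] at hsymm
  set j : E3 × ℝ → E3 × ℝ × ℝ := fun z => (z.1, 0, z.2) with hj
  have hjc : Continuous j := by fun_prop
  have hjs : ContDiff ℝ ∞ j := by fun_prop
  have hσ : ∀ᶠ z in 𝓝 (y₀, t₀), j z ∈ e.target ∧ ContDiffAt ℝ ∞ (fun z => e.symm (j z)) z := by
    have : Tendsto j (𝓝 (y₀, t₀)) (𝓝 (y₀, 0, t₀)) := hjc.continuousAt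
    filter_upwards [this.eventually hsymm] with z hz
    exact ⟨hz.1, ContDiffAt.comp (g := e.symm) z hz.2 hjs.contDiffAt⟩
  have hσ0 : e.symm (j (y₀, t₀)) = a₀ := by
    have := e.left_inv hsrc
    rwa [hcoe, hFa] at this
  have hσt : Tendsto (fun z => e.symm (j z)) (𝓝 (y₀, t₀)) (𝓝 a₀) := by
    have := hσ.self_of_nhds.2.continuousAt
    rwa [ContinuousAt, hσ0] at this
  have hσF : ∀ᶠ z in 𝓝 (y₀, t₀), normalMap φ (e.symm (j z)) = j z := by
    filter_upwards [hσ] with z hz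
    have := e.right_inv hz.1
    rwa [hcoe] at this
  have hyt : Tendsto (fun z => (e.symm (j z)).1) (𝓝 (y₀, t₀)) (𝓝 y₀) :=
    (continuous_fst.tendsto a₀).comp hσt
  -- The local inverse supplies a point of `Γ(t)` close to `y₀` at every nearby time. Comparison
  -- with it forces the closest point to converge to `y₀` too.
  have hyΓ : ∀ᶠ z in 𝓝 (y₀, t₀), (e.symm (j z)).1 ∈ Γ z.2 := by
    have hyU : ∀ᶠ z : E3 × ℝ in 𝓝 (y₀, t₀), ((e.symm (j z)).1, z.2) ∈ U :=
      (hyt.prodMk_nhds continuous_snd.continuousAt).eventually (hU.mem_nhds hzU)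
    filter_upwards [hyU, hσF, eventually_time_mem hz₀] with z h1 h2 h3
    refine (hlev _ h1 (Ioo_subset_Icc_self h3)).mpr ?_
    have h4 := congrArg (fun a => a.2.2) h2
    have h5 := congrArg (fun a => a.2.1) h2
    simp only [normalMap, hj] at h4 h5
    rwa [h4] at h5
  have hft : Tendsto (foot Γ) (𝓝 (y₀, t₀)) (𝓝 y₀) := hΓ.tendsto_foot hz₀ hyt hyΓ
  have hft2 : Tendsto (fun z => (foot Γ z, z.2)) (𝓝 (y₀, t₀)) (𝓝 (y₀, t₀)) :=
    hft.prodMk_nhds continuous_snd.continuousAt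
  have hfU : ∀ᶠ z in 𝓝 (y₀, t₀), (foot Γ z, z.2) ∈ U := hft2.eventually (hU.mem_nhds hzU)
  have hgt : Tendsto (fun z => grad φ (foot Γ z, z.2)) (𝓝 (y₀, t₀)) (𝓝 (grad φ (y₀, t₀))) :=
    (contDiffAt_grad (hφat _ hzU)).continuousAt.tendsto.comp hft2
  set c : E3 × ℝ → ℝ := fun z => inner ℝ (z.1 - foot Γ z) (grad φ (foot Γ z, z.2)) /
      ‖grad φ (foot Γ z, z.2)‖ ^ 2 with hc
  have hct : Tendsto c (𝓝 (y₀, t₀)) (𝓝 0) := by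
    have h1 : Tendsto (fun z : E3 × ℝ => z.1 - foot Γ z) (𝓝 (y₀, t₀)) (𝓝 (y₀ - y₀)) :=
      (continuous_fst.tendsto _).sub hft
    have h2 := (h1.inner hgt (𝕜 := ℝ)).div (hgt.norm.pow 2) (by simpa using hg _ hzU)
    simp only [sub_self, inner_zero_left, zero_div] at h2
    exact h2
  have hsub : ∀ᶠ z in 𝓝 (y₀, t₀), z.1 - foot Γ z = c z • grad φ (foot Γ z, z.2) := by
    filter_upwards [hfU, eventually_time_mem hz₀] with z h1 h2
    exact hΓ.sub_foot_eq_smul (Ioo_subset_Icc_self h2) hU h1 (hφat _ h1) (hg _ h1) hlev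
  -- The triple formed by the foot, its multiplier and the time has the same image under `normalMap
  -- φ` as the inverse. Since it converges to `a₀`, it lies in the source of the chart, where
  -- injectivity identifies the two.
  have hmem : ∀ᶠ z in 𝓝 (y₀, t₀), ((foot Γ z, c z, z.2) : E3 × ℝ × ℝ) ∈ e.source :=
    (hft.prodMk_nhds (hct.prodMk_nhds continuous_snd.continuousAt)).eventually
      (e.open_source.mem_nhds hsrc)
  have heq : ∀ᶠ z in 𝓝 (y₀, t₀), e.symm (j z) = (foot Γ z, c z, z.2) := by
    filter_upwards [hmem, hsub, hfU, eventually_time_mem hz₀] with z h1 h2 h3 h4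
    have h5 : normalMap φ (foot Γ z, c z, z.2) = j z := by
      have h6 : φ (foot Γ z, z.2) = 0 := (hlev _ h3 (Ioo_subset_Icc_self h4)).mp
        (hΓ.closestPoint_spec (Ioo_subset_Icc_self h4) z.1).1
      simp only [normalMap, hj, h6, ← h2, add_sub_cancel]
    rw [← h5, ← hcoe, e.left_inv h1]
  refine ⟨c, ?_, ?_⟩
  · filter_upwards [hfU, hσ, hsub, heq.eventually_nhds] with z h1 h2 h3 h4
    refine ⟨h1, ?_, ?_, h3⟩
    · refine (contDiffAt_fst.comp z h2.2).congr_of_eventuallyEq ?_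
      filter_upwards [h4] with w hw
      simp [hw]
    · refine ((contDiffAt_fst.comp _ contDiffAt_snd).comp z h2.2).congr_of_eventuallyEq ?_
      filter_upwards [h4] with w hw
      simp [hw]
  · have h1 : Tendsto (fun r : ℝ => (y₀ + r • grad φ (y₀, t₀), t₀)) (𝓝 0) (𝓝 (y₀, t₀)) := by
      have : Continuous (fun r : ℝ => (y₀ + r • grad φ (y₀, t₀), t₀)) := by fun_prop
      simpa using this.tendsto 0
    have h2 : Tendsto (fun r : ℝ => ((y₀, r, t₀) : E3 × ℝ × ℝ)) (𝓝 0) (𝓝 a₀) :=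
      (by fun_prop : Continuous fun r : ℝ => ((y₀, r, t₀) : E3 × ℝ × ℝ)).tendsto 0
    filter_upwards [h1.eventually heq, h2.eventually (e.open_source.mem_nhds hsrc)] with r h3 h4
    have h5 : normalMap φ (y₀, r, t₀) = j (y₀ + r • grad φ (y₀, t₀), t₀) := by
      simp [normalMap, hj, hφ0]
    rw [← h5, ← hcoe, e.left_inv h4] at h3
    exact (congrArg Prod.fst h3).symm

/-- Everything is expressed by a level set function at the foot: `ν̄ = ∇φ/|∇φ|` and `d = s |∇φ|`,
where `x - π = s ∇φ`. Smoothness of `π` and `s` therefore carries over to `ν̄` and `d`. -/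
theorem IsMovingClosedSurface.eventually_isTubePoint {T : ℝ} {Γ : ℝ → Set E3}
    {ν : E3 × ℝ → E3} {V : E3 × ℝ → ℝ} (hΓ : IsMovingClosedSurface T Γ ν V) {z₀ : E3 × ℝ}
    (hz₀ : z₀ ∈ spaceTimeSurface T Γ) :
    (∀ᶠ z in 𝓝 z₀, IsTubePoint T Γ ν V z) ∧
      ∀ᶠ r in 𝓝 (0 : ℝ), foot Γ (z₀.1 + r • ν z₀, z₀.2) = z₀.1 := by
  obtain ⟨U, φ, hU, hzU, hφ, hg, hlev, hνV⟩ :=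
    hΓ.exists_levelSet z₀.2 (spaceTimeSurface_time hz₀) z₀.1 hz₀.2
  have hφat : ∀ z ∈ U, ContDiffAt ℝ ∞ φ z := fun z hz => hφ.contDiffAt (hU.mem_nhds hz)
  obtain ⟨s, hs, hline⟩ := hΓ.exists_eventuallyEq_foot hz₀ hU hzU hφ hg hlev
  have hext : ∀ᶠ z in 𝓝 z₀, (foot Γ z ∈ Γ z.2 ∧ φ (foot Γ z, z.2) = 0 ∧
      normalExt Γ ν z = ‖grad φ (foot Γ z, z.2)‖⁻¹ • grad φ (foot Γ z, z.2) ∧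
      normalExt Γ V z = -dt φ (foot Γ z, z.2) / ‖grad φ (foot Γ z, z.2)‖) ∧
      signedDist Γ ν z = s z * ‖grad φ (foot Γ z, z.2)‖ := by
    filter_upwards [hs, eventually_time_mem hz₀] with z h1 h2
    have ht := Ioo_subset_Icc_self h2
    have hspec := hΓ.closestPoint_spec ht z.1
    have h3 := hνV (foot Γ z, z.2) h1.1 ht hspec.1
    have hpos : 0 < ‖grad φ (foot Γ z, z.2)‖ := norm_pos_iff.mpr (hg _ h1.1)
    have hne : normalExt Γ ν z = ‖grad φ (foot Γ z, z.2)‖⁻¹ • grad φ (foot Γ z, z.2) := h3.1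
    refine ⟨⟨hspec.1, (hlev _ h1.1 ht).mp hspec.1, hne, h3.2⟩, ?_⟩
    have h4 : Metric.infDist z.1 (Γ z.2) = |s z| * ‖grad φ (foot Γ z, z.2)‖ := by
      rw [← hspec.2, dist_eq_norm]
      change ‖z.1 - foot Γ z‖ = _
      rw [h1.2.2.2, norm_smul, Real.norm_eq_abs]
    have h5 : inner ℝ (z.1 - closestPoint (Γ z.2) z.1) (normalExt Γ ν z) =
        s z * ‖grad φ (foot Γ z, z.2)‖ := by
      change inner ℝ (z.1 - foot Γ z) _ = _
      rw [h1.2.2.2, hne, real_inner_smul_left, real_inner_smul_right, real_inner_self_eq_norm_sq]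
      field_simp
    rw [signedDist, h5, h4]
    have h6 : |s z| * ‖grad φ (foot Γ z, z.2)‖ = |s z * ‖grad φ (foot Γ z, z.2)‖| := by
      rw [abs_mul, abs_of_pos hpos]
    rw [h6, sign_mul_abs_self]
  constructor
  · filter_upwards [hs.eventually_nhds, hext.eventually_nhds, eventually_time_mem hz₀]
      with z hsz hez htz
    obtain ⟨h1, h2, h3, h4⟩ := hsz.self_of_nhds
    obtain ⟨⟨h5, h6, h7, h8⟩, h9⟩ := hez.self_of_nhds
    have hpos : 0 < ‖grad φ (foot Γ z, z.2)‖ := norm_pos_iff.mpr (hg _ h1)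
    have hft : ContDiffAt ℝ ∞ (fun w => (foot Γ w, w.2)) z := h2.prodMk contDiffAt_snd
    have hgr : ContDiffAt ℝ ∞ (fun w => grad φ (foot Γ w, w.2)) z :=
      ContDiffAt.comp (g := grad φ) z (contDiffAt_grad (hφat _ h1)) hft
    have hgn : ContDiffAt ℝ ∞ (fun w => ‖grad φ (foot Γ w, w.2)‖) z := hgr.norm ℝ (hg _ h1)
    have h10 : z.1 - foot Γ z = signedDist Γ ν z • normalExt Γ ν z := by
      rw [h9, h7, h4, smul_smul, mul_assoc, mul_inv_cancel₀ hpos.ne', mul_one]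
    have h11 : ‖normalExt Γ ν z‖ = 1 := by
      rw [h7, norm_smul, norm_inv, norm_norm, inv_mul_cancel₀ hpos.ne']
    refine ⟨htz, h5, h2, ?_, ?_, ?_, h10, h11, ?_⟩
    · refine ((hgn.inv hpos.ne').smul hgr).congr_of_eventuallyEq ?_
      filter_upwards [hez] with w hw using hw.1.2.2.1
    · refine (h3.mul hgn).congr_of_eventuallyEq ?_
      filter_upwards [hez] with w hw using hw.2
    · have h12 := (hΓ.closestPoint_spec (Ioo_subset_Icc_self htz) z.1).2
      rw [← h12, dist_eq_norm]
      change ‖z.1 - foot Γ z‖ = _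
      rw [h10, norm_smul, h11, Real.norm_eq_abs, mul_one]
    · intro h k
      -- Differentiating the identity `φ(π, t) = 0` gives `∇φ · ∂π = -k ∂ₜφ`. Division by `|∇φ|`
      -- turns this into the normal speed of the foot.
      have h12 : HasFDerivAt (fun w => φ (foot Γ w, w.2)) ((fderiv ℝ φ (foot Γ z, z.2)).comp
          ((fderiv ℝ (foot Γ) z).prod (ContinuousLinearMap.snd ℝ E3 ℝ))) z :=
        HasFDerivAt.comp (g := φ) z ((hφat _ h1).differentiableAt (by simp)).hasFDerivAt
          ((h2.differentiableAt (by simp)).hasFDerivAt.prodMk hasFDerivAt_snd)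
      have h13 : HasFDerivAt (fun w => φ (foot Γ w, w.2)) (0 : E3 × ℝ →L[ℝ] ℝ) z := by
        refine (hasFDerivAt_const (0 : ℝ) z).congr_of_eventuallyEq ?_
        filter_upwards [hez] with w hw using hw.1.2.1
      have h14 := congrArg (fun L => L (h, k)) (h12.unique h13)
      simp only [ContinuousLinearMap.comp_apply, ContinuousLinearMap.prod_apply,
        ContinuousLinearMap.coe_snd', zero_apply, fderiv_apply_eq_inner_add] at h14
      rw [h7, h8, real_inner_smul_left]
      field_simp
      linarith
  · have h1 := hνV z₀ hzU (spaceTimeSurface_time hz₀) hz₀.2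
    have h2 : Tendsto (fun r : ℝ => r * ‖grad φ z₀‖⁻¹) (𝓝 0) (𝓝 0) := by
      simpa using (continuous_mul_const (‖grad φ z₀‖⁻¹)).tendsto (0 : ℝ)
    filter_upwards [h2.eventually hline] with r hr
    rw [h1.1, smul_smul]
    exact hr

/-- Differentiate `d = (x - π) · ν̄`. Since `x - π` is parallel to `ν̄` and `|ν̄| = 1`, the
derivative of `ν̄` contributes nothing, while `∂π · ν̄ = V̄ k`. -/
theorem fderiv_signedDist {T : ℝ} {Γ : ℝ → Set E3} {ν : E3 × ℝ → E3} {V : E3 × ℝ → ℝ}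
    {z : E3 × ℝ} (hz : ∀ᶠ w in 𝓝 z, IsTubePoint T Γ ν V w) (h : E3) (k : ℝ) :
    fderiv ℝ (signedDist Γ ν) z (h, k) =
      inner ℝ (normalExt Γ ν z) h - normalExt Γ V z * k := by
  have hz0 := hz.self_of_nhds
  have hν := (hz0.contDiffAt_normal.differentiableAt (by simp)).hasFDerivAt
  have hf := (hz0.contDiffAt_foot.differentiableAt (by simp)).hasFDerivAt
  have h1 : signedDist Γ ν =ᶠ[𝓝 z] fun w => inner ℝ (w.1 - foot Γ w) (normalExt Γ ν w) := by
    filter_upwards [hz] with w hw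
    rw [hw.sub_foot, real_inner_smul_left, real_inner_self_eq_norm_sq, hw.norm_normal]
    simp
  have h2 : HasFDerivAt (fun w => inner ℝ (w.1 - foot Γ w) (normalExt Γ ν w)) _ z :=
    (hasFDerivAt_fst.sub hf).inner ℝ hν
  have h3 : inner ℝ (normalExt Γ ν z) (fderiv ℝ (normalExt Γ ν) z (h, k)) = 0 := by
    have h4 := hν.norm_sq
    have h5 : HasFDerivAt (fun w => ‖normalExt Γ ν w‖ ^ 2) (0 : E3 × ℝ →L[ℝ] ℝ) z := by
      refine (hasFDerivAt_const (1 : ℝ) z).congr_of_eventuallyEq ?_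
      filter_upwards [hz] with w hw
      rw [hw.norm_normal, one_pow]
    have h6 := congrArg (fun L => L (h, k)) (h4.unique h5)
    simpa using h6
  rw [h1.fderiv_eq, h2.fderiv]
  simp only [ContinuousLinearMap.comp_apply, ContinuousLinearMap.prod_apply,
    fderivInnerCLM_apply, sub_apply, Pi.sub_apply, ContinuousLinearMap.coe_fst']
  rw [hz0.sub_foot, real_inner_smul_left, h3, inner_sub_left, real_inner_comm _ h,
    real_inner_comm _ (fderiv ℝ (foot Γ) z (h, k)), hz0.inner_fderiv_foot]
  ring

/-! ### Calculus of constant normal extensions at points of the surface -/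

section Surface

variable {T : ℝ} {Γ : ℝ → Set E3} {ν : E3 × ℝ → E3} {V : E3 × ℝ → ℝ} {z₀ : E3 × ℝ}

theorem normalExt_of_mem {F : Type*} (f : E3 × ℝ → F) (hz₀ : z₀ ∈ spaceTimeSurface T Γ) :
    normalExt Γ f z₀ = f z₀ := by
  rw [normalExt, closestPoint_of_mem hz₀.2]

theorem signedDist_of_mem (hz₀ : z₀ ∈ spaceTimeSurface T Γ) : signedDist Γ ν z₀ = 0 := by
  rw [signedDist, closestPoint_of_mem hz₀.2, sub_self, inner_zero_left, Real.sign_zero, zero_mul]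

theorem norm_normal (hΓ : IsMovingClosedSurface T Γ ν V) (hz₀ : z₀ ∈ spaceTimeSurface T Γ) :
    ‖ν z₀‖ = 1 := by
  have := (hΓ.eventually_isTubePoint hz₀).1.self_of_nhds.norm_normal
  rwa [normalExt_of_mem ν hz₀] at this

theorem fderiv_signedDist_of_mem (hΓ : IsMovingClosedSurface T Γ ν V)
    (hz₀ : z₀ ∈ spaceTimeSurface T Γ) (h : E3) (k : ℝ) :
    fderiv ℝ (signedDist Γ ν) z₀ (h, k) = inner ℝ (ν z₀) h - V z₀ * k := by
  rw [fderiv_signedDist (hΓ.eventually_isTubePoint hz₀).1, normalExt_of_mem ν hz₀,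
    normalExt_of_mem V hz₀]

/-- In `π = x - d ν̄` the derivative of `ν̄` is multiplied by `d = 0`. What remains is the
projection onto the tangent space of the space-time track. -/
theorem fderiv_foot_of_mem (hΓ : IsMovingClosedSurface T Γ ν V)
    (hz₀ : z₀ ∈ spaceTimeSurface T Γ) (h : E3) (k : ℝ) :
    fderiv ℝ (foot Γ) z₀ (h, k) = h - (inner ℝ (ν z₀) h - V z₀ * k) • ν z₀ := by
  have htube := (hΓ.eventually_isTubePoint hz₀).1
  have ht := htube.self_of_nhds
  have hd := (ht.contDiffAt_signedDist.differentiableAt (by simp)).hasFDerivAt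
  have hn := (ht.contDiffAt_normal.differentiableAt (by simp)).hasFDerivAt
  have h1 : foot Γ =ᶠ[𝓝 z₀] fun w => w.1 - signedDist Γ ν w • normalExt Γ ν w := by
    filter_upwards [htube] with w hw
    rw [← hw.sub_foot, sub_sub_cancel]
  have h2 : HasFDerivAt (fun w => w.1 - signedDist Γ ν w • normalExt Γ ν w) _ z₀ :=
    hasFDerivAt_fst.sub (hd.smul hn)
  rw [h1.fderiv_eq, h2.fderiv]
  simp [signedDist_of_mem hz₀, normalExt_of_mem ν hz₀, fderiv_signedDist_of_mem hΓ hz₀]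

/-- The map `z ↦ (π, t)` takes values in the space-time surface and fixes `z₀`, so a local extension
valid near `z₀` on the surface can replace `f` on a full neighbourhood. -/
theorem normalExt_eventuallyEq {F : Type*} (hΓ : IsMovingClosedSurface T Γ ν V)
    (hz₀ : z₀ ∈ spaceTimeSurface T Γ) {f g : E3 × ℝ → F}
    (hfg : ∀ᶠ w in 𝓝[spaceTimeSurface T Γ] z₀, g w = f w) :
    normalExt Γ f =ᶠ[𝓝 z₀] fun z => g (foot Γ z, z.2) := by
  have htube := (hΓ.eventually_isTubePoint hz₀).1
  have h1 : Tendsto (fun z => (foot Γ z, z.2)) (𝓝 z₀) (𝓝 z₀) := by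
    have : ContinuousAt (fun z => (foot Γ z, z.2)) z₀ :=
      htube.self_of_nhds.contDiffAt_foot.continuousAt.prodMk continuousAt_snd
    simpa [ContinuousAt, foot_of_mem hz₀] using this
  have h2 : Tendsto (fun z => (foot Γ z, z.2)) (𝓝 z₀) (𝓝[spaceTimeSurface T Γ] z₀) := by
    refine tendsto_nhdsWithin_iff.mpr ⟨h1, ?_⟩
    filter_upwards [htube] with w hw using ⟨hw.time_mem, hw.foot_mem⟩
  filter_upwards [h2.eventually hfg] with w hw using hw.symm

variable {F : Type*} [NormedAddCommGroup F] [NormedSpace ℝ F]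

/-- At a point of the surface, the derivative of the constant normal extension of `f` is the
derivative of any extension of `f` along the projection onto the space-time tangent space. -/
theorem hasFDerivAt_normalExt (hΓ : IsMovingClosedSurface T Γ ν V)
    (hz₀ : z₀ ∈ spaceTimeSurface T Γ) {f g : E3 × ℝ → F} (hg : DifferentiableAt ℝ g z₀)
    (hfg : ∀ᶠ w in 𝓝[spaceTimeSurface T Γ] z₀, g w = f w) :
    DifferentiableAt ℝ (normalExt Γ f) z₀ ∧ ∀ h k, fderiv ℝ (normalExt Γ f) z₀ (h, k) =
      fderiv ℝ g z₀ (h - (inner ℝ (ν z₀) h - V z₀ * k) • ν z₀, k) := by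
  have ht := (hΓ.eventually_isTubePoint hz₀).1.self_of_nhds
  have heq := normalExt_eventuallyEq hΓ hz₀ hfg
  have h0 : (foot Γ z₀, z₀.2) = z₀ := by rw [foot_of_mem hz₀]
  have hg' : HasFDerivAt g (fderiv ℝ g z₀) (foot Γ z₀, z₀.2) := by
    rw [h0]
    exact hg.hasFDerivAt
  have h1 : HasFDerivAt (fun z => g (foot Γ z, z.2)) _ z₀ := HasFDerivAt.comp (g := g) z₀ hg'
    ((ht.contDiffAt_foot.differentiableAt (by simp)).hasFDerivAt.prodMk hasFDerivAt_snd)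
  refine ⟨(h1.congr_of_eventuallyEq heq).differentiableAt, fun h k => ?_⟩
  rw [(h1.congr_of_eventuallyEq heq).fderiv]
  simp [fderiv_foot_of_mem hΓ hz₀]

theorem SmoothOnSurface.contDiffAt_normalExt (hΓ : IsMovingClosedSurface T Γ ν V)
    (hz₀ : z₀ ∈ spaceTimeSurface T Γ) {f : E3 × ℝ → F} (hf : SmoothOnSurface T Γ f) :
    ContDiffAt ℝ ∞ (normalExt Γ f) z₀ := by
  obtain ⟨g, hg, hfg⟩ := hf z₀ hz₀
  have ht := (hΓ.eventually_isTubePoint hz₀).1.self_of_nhds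
  have h0 : (foot Γ z₀, z₀.2) = z₀ := by rw [foot_of_mem hz₀]
  refine ContDiffAt.congr_of_eventuallyEq ?_ (normalExt_eventuallyEq hΓ hz₀ hfg)
  exact ContDiffAt.comp (g := g) z₀ (by rwa [h0]) (ht.contDiffAt_foot.prodMk contDiffAt_snd)

theorem SmoothOnSurface.fderiv_normalExt_normal (hΓ : IsMovingClosedSurface T Γ ν V)
    (hz₀ : z₀ ∈ spaceTimeSurface T Γ) {f : E3 × ℝ → F} (hf : SmoothOnSurface T Γ f) :
    fderiv ℝ (normalExt Γ f) z₀ (ν z₀, 0) = 0 := by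
  obtain ⟨g, hg, hfg⟩ := hf z₀ hz₀
  rw [(hasFDerivAt_normalExt hΓ hz₀ (hg.differentiableAt (by simp)) hfg).2,
    real_inner_self_eq_norm_sq, norm_normal hΓ hz₀]
  simp only [one_pow, mul_zero, sub_zero, one_smul, sub_self]
  exact map_zero _

theorem SmoothOnSurface.apply {f : E3 × ℝ → E3} (hf : SmoothOnSurface T Γ f) (j : Fin 3) :
    SmoothOnSurface T Γ fun w => f w j := by
  intro z hz
  obtain ⟨g, hg, hfg⟩ := hf z hz
  refine ⟨fun w => g w j, contDiffAt_euclidean.mp hg j, ?_⟩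
  filter_upwards [hfg] with w hw
  rw [hw]

/-- The tangential derivative in terms of an arbitrary extension. -/
theorem tanD_eq (hΓ : IsMovingClosedSurface T Γ ν V) (hz₀ : z₀ ∈ spaceTimeSurface T Γ)
    {f g : E3 × ℝ → ℝ} (hg : DifferentiableAt ℝ g z₀)
    (hfg : ∀ᶠ w in 𝓝[spaceTimeSurface T Γ] z₀, g w = f w) (i : Fin 3) :
    tanD Γ ν i f z₀ = dx i g z₀ - ν z₀ i * fderiv ℝ g z₀ (ν z₀, 0) := by
  have h1 := (hasFDerivAt_normalExt hΓ hz₀ hg hfg).2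
  have h2 : tanD Γ ν i f z₀ =
      fderiv ℝ (normalExt Γ f) z₀ (EuclideanSpace.single i 1 - ν z₀ i • ν z₀, 0) := by
    rw [map_spatial_eq_sum]
    simp only [tanD, proj, dx, smul_eq_mul]
    refine Finset.sum_congr rfl fun j _ => ?_
    congr 1
    simp [Matrix.one_apply, Matrix.vecMulVec_apply, eq_comm]
  rw [h2, h1]
  have h3 : inner ℝ (ν z₀) (EuclideanSpace.single i (1 : ℝ) - ν z₀ i • ν z₀) = 0 := by
    rw [inner_sub_right, real_inner_smul_right, real_inner_self_eq_norm_sq,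
      norm_normal hΓ hz₀, EuclideanSpace.inner_single_right]
    simp
  rw [h3]
  have h4 : ((EuclideanSpace.single i (1 : ℝ) - ν z₀ i • ν z₀ - (0 - V z₀ * 0) • ν z₀, 0) : E3 × ℝ) =
      (EuclideanSpace.single i 1, 0) - ν z₀ i • (ν z₀, 0) := by
    simp
  rw [h4, map_sub, map_smul, smul_eq_mul, dx]

/-- The constant normal extension of a smooth function has only tangential derivatives. -/
theorem tanD_eq_dx (hΓ : IsMovingClosedSurface T Γ ν V) (hz₀ : z₀ ∈ spaceTimeSurface T Γ)
    {f : E3 × ℝ → ℝ} (hf : SmoothOnSurface T Γ f) (i : Fin 3) :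
    tanD Γ ν i f z₀ = dx i (normalExt Γ f) z₀ := by
  have h : ∀ᶠ w in 𝓝[spaceTimeSurface T Γ] z₀, normalExt Γ f w = f w := by
    filter_upwards [self_mem_nhdsWithin] with w hw using normalExt_of_mem f hw
  rw [tanD_eq hΓ hz₀ ((hf.contDiffAt_normalExt hΓ hz₀).differentiableAt (by simp)) h,
    hf.fderiv_normalExt_normal hΓ hz₀, mul_zero, sub_zero]

end Surface

/-! ### The boundary of the thin domain -/

section Boundary

variable {T : ℝ} {Γ : ℝ → Set E3} {ν : E3 × ℝ → E3} {V : E3 × ℝ → ℝ} {z₀ : E3 × ℝ}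

theorem normalExt_of_foot_eq {F : Type*} (f : E3 × ℝ → F) {r : ℝ}
    (h : foot Γ (z₀.1 + r • ν z₀, z₀.2) = z₀.1) :
    normalExt Γ f (z₀.1 + r • ν z₀, z₀.2) = f z₀ := by
  change f (foot Γ (z₀.1 + r • ν z₀, z₀.2), z₀.2) = f z₀
  rw [h]

theorem tendsto_normalLine (z₀ : E3 × ℝ) (n : E3) :
    Tendsto (fun r : ℝ => (z₀.1 + r • n, z₀.2)) (𝓝 0) (𝓝 z₀) := by
  have : Continuous (fun r : ℝ => (z₀.1 + r • n, z₀.2)) := by fun_prop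
  simpa using this.tendsto 0

/-- Once the foot of `y + rν` is known to be `y`, the relation `x - π = d ν̄` reads `rν = dν`. -/
theorem eventually_normalLine (hΓ : IsMovingClosedSurface T Γ ν V)
    (hz₀ : z₀ ∈ spaceTimeSurface T Γ) :
    ∀ᶠ r in 𝓝 (0 : ℝ), foot Γ (z₀.1 + r • ν z₀, z₀.2) = z₀.1 ∧
      signedDist Γ ν (z₀.1 + r • ν z₀, z₀.2) = r ∧
      ∀ᶠ w in 𝓝 (z₀.1 + r • ν z₀, z₀.2), IsTubePoint T Γ ν V w := by
  obtain ⟨h1, h2⟩ := hΓ.eventually_isTubePoint hz₀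
  filter_upwards [h2, (tendsto_normalLine z₀ (ν z₀)).eventually h1.eventually_nhds] with r h3 h4
  refine ⟨h3, ?_, h4⟩
  have h5 := h4.self_of_nhds.sub_foot
  rw [h3, normalExt_of_foot_eq ν h3, add_sub_cancel_left] at h5
  have hν : ν z₀ ≠ 0 := by
    intro h
    have := norm_normal hΓ hz₀
    rw [h, norm_zero] at this
    exact zero_ne_one this
  exact (smul_left_injective ℝ hν h5).symm

/-- The defining function is `d - ε`. Its derivatives at `y + εν` are those of the signed distance,
given by `ν` and `V` at the foot `y`. -/
theorem eventually_hasOutwardNormal (hΓ : IsMovingClosedSurface T Γ ν V)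
    (hz₀ : z₀ ∈ spaceTimeSurface T Γ) :
    ∀ᶠ ε in 𝓝[>] (0 : ℝ), z₀.1 + ε • ν z₀ ∈ frontier (thinDomain Γ ε z₀.2) ∧
      HasOutwardNormal (thinDomain Γ ε) (z₀.1 + ε • ν z₀, z₀.2) (ν z₀) (V z₀) := by
  filter_upwards [(eventually_normalLine hΓ hz₀).filter_mono nhdsWithin_le_nhds,
    self_mem_nhdsWithin] with ε h1 hε
  rw [mem_Ioi] at hε
  obtain ⟨hfoot, hd, htube⟩ := h1
  have hz := htube.self_of_nhds
  have hne : ∀ t ∈ Ioo 0 T, (Γ t).Nonempty := fun t ht =>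
    (hΓ.isConnected t (Ioo_subset_Icc_self ht)).nonempty
  have hinf : Metric.infDist (z₀.1 + ε • ν z₀) (Γ z₀.2) = ε := by
    have := hz.infDist_eq
    rwa [hd, abs_of_pos hε] at this
  constructor
  · rw [thinDomain, frontier, Metric.isOpen_thickening.interior_eq, closure_thickening hε]
    refine ⟨?_, ?_⟩
    · exact Metric.mem_cthickening_of_dist_le _ z₀.1 _ _ hz₀.2
        (by rw [dist_eq_norm, add_sub_cancel_left, norm_smul, norm_normal hΓ hz₀, mul_one,
              Real.norm_of_nonneg hε.le])
    · rw [Metric.mem_thickening_iff_infDist_lt (hne _ hz₀.1), hinf]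
      exact lt_irrefl _
  · have hfd : fderiv ℝ (fun w => signedDist Γ ν w - ε) (z₀.1 + ε • ν z₀, z₀.2) =
        fderiv ℝ (signedDist Γ ν) (z₀.1 + ε • ν z₀, z₀.2) := fderiv_sub_const _
    have hgrad : grad (fun w => signedDist Γ ν w - ε) (z₀.1 + ε • ν z₀, z₀.2) = ν z₀ := by
      ext i
      simp only [grad, dx]
      rw [hfd, fderiv_signedDist htube, normalExt_of_foot_eq ν hfoot,
        EuclideanSpace.inner_single_right]
      simp
    have hdt : dt (fun w => signedDist Γ ν w - ε) (z₀.1 + ε • ν z₀, z₀.2) = -V z₀ := by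
      rw [dt, hfd, fderiv_signedDist htube, normalExt_of_foot_eq V hfoot]
      simp
    have hn := norm_normal hΓ hz₀
    refine ⟨fun w => signedDist Γ ν w - ε, hz.contDiffAt_signedDist.sub contDiffAt_const,
      by simp [hd], ?_, ?_, ?_, ?_⟩
    · rw [hgrad]
      intro h
      rw [h, norm_zero] at hn
      exact zero_ne_one hn
    -- Near the outer sheet `d > 0`, so the distance `|d|` to the surface is `d` itself.
    · have hpos : ∀ᶠ w in 𝓝 (z₀.1 + ε • ν z₀, z₀.2), 0 < signedDist Γ ν w :=
        hz.contDiffAt_signedDist.continuousAt.eventually (lt_mem_nhds (by rw [hd]; exact hε))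
      filter_upwards [htube, hpos] with w hw hwpos
      rw [thinDomain, Metric.mem_thickening_iff_infDist_lt (hne _ hw.time_mem), hw.infDist_eq,
        abs_of_pos hwpos, sub_neg]
    · rw [hgrad, hn, inv_one, one_smul]
    · rw [hgrad, hdt, hn, neg_neg, div_one]

theorem mem_thinDomain {ε : ℝ} (hε : 0 < ε) (hz₀ : z₀ ∈ spaceTimeSurface T Γ) :
    z₀.1 ∈ thinDomain Γ ε z₀.2 := Metric.self_subset_thickening hε _ hz₀.2

end Boundary

/-! ### Derivatives of remainders -/

section Remainder

variable {E F : Type*} [NormedAddCommGroup E] [NormedSpace ℝ E] [NormedAddCommGroup F]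
  [NormedSpace ℝ F]

theorem norm_fderiv_sub_apply_le {f g : E → F} {z : E} (hf : ContDiffAt ℝ 1 f z)
    (hg : ContDiffAt ℝ 1 g z) (m : E) :
    ‖fderiv ℝ f z m - fderiv ℝ g z m‖ ≤ ‖iteratedFDeriv ℝ 1 (fun w => f w - g w) z‖ * ‖m‖ := by
  have h : fderiv ℝ (fun w => f w - g w) z = fderiv ℝ f z - fderiv ℝ g z :=
    fderiv_sub (hf.differentiableAt (by simp)) (hg.differentiableAt (by simp))
  rw [norm_iteratedFDeriv_one, h]
  exact (fderiv ℝ f z - fderiv ℝ g z).le_opNorm m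

theorem norm_fderiv_fderiv_sub_apply_le {f g : E → F} {z : E} (hf : ContDiffAt ℝ 2 f z)
    (hg : ContDiffAt ℝ 2 g z) (m m' : E) :
    ‖fderiv ℝ (fun w => fderiv ℝ f w m') z m - fderiv ℝ (fun w => fderiv ℝ g w m') z m‖ ≤
      ‖iteratedFDeriv ℝ 2 (fun w => f w - g w) z‖ * (‖m‖ * ‖m'‖) := by
  have key : ∀ {h : E → F}, ContDiffAt ℝ 2 h z →
      fderiv ℝ (fun w => fderiv ℝ h w m') z m = fderiv ℝ (fderiv ℝ h) z m m' := by
    intro h hh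
    have h1 : DifferentiableAt ℝ (fderiv ℝ h) z :=
      (hh.fderiv_right (m := 1) (by norm_num)).differentiableAt (by simp)
    rw [fderiv_clm_apply h1 (differentiableAt_const m')]
    simp
  have h1 : (fun w => fderiv ℝ (fun w => f w - g w) w m') =ᶠ[𝓝 z]
      fun w => fderiv ℝ f w m' - fderiv ℝ g w m' := by
    filter_upwards [hf.eventually (by simp), hg.eventually (by simp)] with w h1 h2
    have h : fderiv ℝ (fun w => f w - g w) w = fderiv ℝ f w - fderiv ℝ g w :=
      fderiv_sub (h1.differentiableAt (by simp)) (h2.differentiableAt (by simp))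
    rw [h, sub_apply]
  have hd : ∀ {h : E → F}, ContDiffAt ℝ 2 h z → DifferentiableAt ℝ (fun w => fderiv ℝ h w m') z :=
    fun hh => ((hh.fderiv_right (m := 1) (by norm_num)).differentiableAt (by simp)).clm_apply
      (differentiableAt_const m')
  have h2 : fderiv ℝ (fun w => fderiv ℝ f w m') z m - fderiv ℝ (fun w => fderiv ℝ g w m') z m =
      iteratedFDeriv ℝ 2 (fun w => f w - g w) z ![m, m'] := by
    rw [iteratedFDeriv_two_apply]
    simp only [Matrix.cons_val_zero, Matrix.cons_val_one]
    rw [← key (hf.sub hg), h1.fderiv_eq, fderiv_fun_sub (hd hf) (hd hg), sub_apply]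
  rw [h2]
  refine ((iteratedFDeriv ℝ 2 (fun w => f w - g w) z).le_opNorm _).trans (le_of_eq ?_)
  simp [Fin.prod_univ_two]

end Remainder

section Components

variable {E : Type*} [NormedAddCommGroup E] [NormedSpace ℝ E]

theorem fderiv_component {f : E → E3} {z : E} (hf : DifferentiableAt ℝ f z) (j : Fin 3) (m : E) :
    fderiv ℝ (fun w => f w j) z m = fderiv ℝ f z m j := by
  have h := (EuclideanSpace.proj (𝕜 := ℝ) j : E3 →L[ℝ] ℝ).hasFDerivAt.comp z hf.hasFDerivAt
  have h2 : HasFDerivAt (fun w => f w j) _ z := h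
  rw [h2.fderiv]
  rfl

theorem contDiffAt_component {f : E → E3} {z : E} {n : WithTop ℕ∞} (hf : ContDiffAt ℝ n f z)
    (j : Fin 3) : ContDiffAt ℝ n (fun w => f w j) z := contDiffAt_euclidean.mp hf j

theorem norm_iteratedFDeriv_component_le {f : E → E3} {z : E} {n : ℕ} (hf : ContDiffAt ℝ n f z)
    (j : Fin 3) : ‖iteratedFDeriv ℝ n (fun w => f w j) z‖ ≤ ‖iteratedFDeriv ℝ n f z‖ := by
  have h := (EuclideanSpace.proj (𝕜 := ℝ) j : E3 →L[ℝ] ℝ).iteratedFDeriv_comp_left hf le_rfl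
  have h2 : iteratedFDeriv ℝ n (fun w => f w j) z = _ := h
  rw [h2]
  refine (ContinuousLinearMap.norm_compContinuousMultilinearMap_le _ _).trans ?_
  refine mul_le_of_le_one_left (norm_nonneg _) ?_
  refine ContinuousLinearMap.opNorm_le_bound _ zero_le_one fun x => ?_
  rw [one_mul]
  exact PiLp.norm_apply_le x j

end Components

/-! ### Vanishing coefficients -/

theorem tendsto_pow_nhdsGT_zero {n : ℕ} (hn : n ≠ 0) :
    Tendsto (fun ε : ℝ => ε ^ n) (𝓝[>] 0) (𝓝 0) := by
  have h := (continuous_pow n : Continuous fun ε : ℝ => ε ^ n).tendsto 0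
  rw [zero_pow hn] at h
  exact h.mono_left nhdsWithin_le_nhds

/-- Letting `ε → 0` removes the constant term, and division by `ε` costs one power. Iterating this
extracts Taylor coefficients from a one-sided bound. -/
theorem eq_zero_and_isBigO_of_add_mul {a L : ℝ} {g : ℝ → ℝ} {n : ℕ}
    (hg : Tendsto g (𝓝[>] 0) (𝓝 L))
    (h : (fun ε => a + ε * g ε) =O[𝓝[>] (0 : ℝ)] fun ε => ε ^ (n + 1)) :
    a = 0 ∧ g =O[𝓝[>] (0 : ℝ)] fun ε => ε ^ n := by
  have h1 : Tendsto (fun ε => a + ε * g ε) (𝓝[>] 0) (𝓝 0) :=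
    h.trans_tendsto (tendsto_pow_nhdsGT_zero n.succ_ne_zero)
  have h2 : Tendsto (fun ε => a + ε * g ε) (𝓝[>] 0) (𝓝 (a + 0 * L)) :=
    ((tendsto_id.mono_left nhdsWithin_le_nhds).mul hg).const_add a
  have ha : a = 0 := by simpa using tendsto_nhds_unique h2 h1
  refine ⟨ha, ?_⟩
  have h3 := h.mul (Asymptotics.isBigO_refl (fun ε : ℝ => ε⁻¹) (𝓝[>] 0))
  refine h3.congr' ?_ ?_
  · filter_upwards [self_mem_nhdsWithin] with ε hε
    have : ε ≠ 0 := (mem_Ioi.mp hε).ne'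
    rw [ha]
    field_simp
    ring
  · filter_upwards [self_mem_nhdsWithin] with ε hε
    have : ε ≠ 0 := (mem_Ioi.mp hε).ne'
    rw [pow_succ, mul_assoc, mul_inv_cancel₀ this, mul_one]

theorem coeff_eq_zero_of_isBigO {a b c : ℝ}
    (h : (fun ε => a + ε * (b + ε * c)) =O[𝓝[>] (0 : ℝ)] fun ε => ε ^ 3) :
    a = 0 ∧ b = 0 ∧ c = 0 := by
  have h0 : Tendsto (fun ε : ℝ => b + ε * c) (𝓝[>] 0) (𝓝 (b + 0 * c)) :=
    ((by fun_prop : Continuous fun ε : ℝ => b + ε * c).tendsto 0).mono_left nhdsWithin_le_nhds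
  obtain ⟨ha, h1⟩ := eq_zero_and_isBigO_of_add_mul (n := 2) h0 h
  obtain ⟨hb, h2⟩ := eq_zero_and_isBigO_of_add_mul (n := 1) (g := fun _ => c)
    tendsto_const_nhds h1
  have h3 : Tendsto (fun _ : ℝ => c) (𝓝[>] 0) (𝓝 0) :=
    h2.trans_tendsto (tendsto_pow_nhdsGT_zero one_ne_zero)
  exact ⟨ha, hb, tendsto_nhds_unique tendsto_const_nhds h3⟩

/-- The slope at `0` converges to `g'`, so it can serve as the second factor in `g ε = g 0 + ε ·
slope`. -/
theorem eq_zero_of_isBigO_sq {g : ℝ → ℝ} {g' : ℝ} (hg : HasDerivAt g g' 0)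
    (h : g =O[𝓝[>] (0 : ℝ)] fun ε => ε ^ 2) : g 0 = 0 ∧ g' = 0 := by
  have hs : Tendsto (slope g 0) (𝓝[>] 0) (𝓝 g') :=
    (hasDerivAt_iff_tendsto_slope.mp hg).mono_left
      (nhdsWithin_mono _ fun _ hx => (mem_Ioi.mp hx).ne')
  have heq : ∀ ε ∈ Ioi (0 : ℝ), g ε = g 0 + ε * slope g 0 ε := by
    intro ε hε
    have : ε ≠ 0 := (mem_Ioi.mp hε).ne'
    rw [slope_def_field]
    field_simp
    ring
  obtain ⟨h0, h1⟩ := eq_zero_and_isBigO_of_add_mul (a := g 0) (n := 1) hs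
    (h.congr' (by filter_upwards [self_mem_nhdsWithin] with ε hε using heq ε hε) EventuallyEq.rfl)
  have h2 : Tendsto (slope g 0) (𝓝[>] 0) (𝓝 0) :=
    h1.trans_tendsto (tendsto_pow_nhdsGT_zero one_ne_zero)
  exact ⟨h0, tendsto_nhds_unique hs h2⟩

/-! ### The expansion in the signed distance -/

/-- The function `v(π, t) + d v¹(π, t) + d² v²(π, t)`. -/
def expansion (Γ : ℝ → Set E3) (ν v v1 v2 : E3 × ℝ → E3) (z : E3 × ℝ) : E3 :=
  normalExt Γ v z + signedDist Γ ν z • normalExt Γ v1 z + signedDist Γ ν z ^ 2 • normalExt Γ v2 z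

section Expansion

variable {T : ℝ} {Γ : ℝ → Set E3} {ν : E3 × ℝ → E3} {V : E3 × ℝ → ℝ} {z₀ : E3 × ℝ}
  {v v1 v2 : E3 × ℝ → E3}

theorem contDiffAt_expansion (hΓ : IsMovingClosedSurface T Γ ν V)
    (hz₀ : z₀ ∈ spaceTimeSurface T Γ) (hv : SmoothOnSurface T Γ v)
    (hv1 : SmoothOnSurface T Γ v1) (hv2 : SmoothOnSurface T Γ v2) :
    ContDiffAt ℝ ∞ (expansion Γ ν v v1 v2) z₀ := by
  have hd := (hΓ.eventually_isTubePoint hz₀).1.self_of_nhds.contDiffAt_signedDist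
  exact ((hv.contDiffAt_normalExt hΓ hz₀).add (hd.smul (hv1.contDiffAt_normalExt hΓ hz₀))).add
    ((hd.pow 2).smul (hv2.contDiffAt_normalExt hΓ hz₀))

theorem expansion_of_mem (hz₀ : z₀ ∈ spaceTimeSurface T Γ) :
    expansion Γ ν v v1 v2 z₀ = v z₀ := by
  simp [expansion, signedDist_of_mem hz₀, normalExt_of_mem v hz₀]

theorem eventually_expansion_normalLine (hΓ : IsMovingClosedSurface T Γ ν V)
    (hz₀ : z₀ ∈ spaceTimeSurface T Γ) (v v1 v2 : E3 × ℝ → E3) :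
    ∀ᶠ r in 𝓝 (0 : ℝ), expansion Γ ν v v1 v2 (z₀.1 + r • ν z₀, z₀.2) =
      v z₀ + r • v1 z₀ + r ^ 2 • v2 z₀ := by
  filter_upwards [eventually_normalLine hΓ hz₀] with r hr
  rw [expansion, hr.2.1, normalExt_of_foot_eq v hr.1, normalExt_of_foot_eq v1 hr.1,
    normalExt_of_foot_eq v2 hr.1]

/-- On the surface `d = 0`, so `v²` and the derivatives of the extension of `v¹` drop out. Only the
derivative of `d` itself multiplies `v¹`. -/
theorem fderiv_expansion (hΓ : IsMovingClosedSurface T Γ ν V)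
    (hz₀ : z₀ ∈ spaceTimeSurface T Γ) (hv : SmoothOnSurface T Γ v)
    (hv1 : SmoothOnSurface T Γ v1) (hv2 : SmoothOnSurface T Γ v2) (h : E3) (k : ℝ) :
    fderiv ℝ (expansion Γ ν v v1 v2) z₀ (h, k) = fderiv ℝ (normalExt Γ v) z₀ (h, k) +
      (inner ℝ (ν z₀) h - V z₀ * k) • v1 z₀ := by
  have hd := ((hΓ.eventually_isTubePoint hz₀).1.self_of_nhds.contDiffAt_signedDist.differentiableAt
    (by simp)).hasFDerivAt
  have hD : ∀ {f : E3 × ℝ → E3}, SmoothOnSurface T Γ f →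
      HasFDerivAt (normalExt Γ f) (fderiv ℝ (normalExt Γ f) z₀) z₀ := fun hf =>
    ((hf.contDiffAt_normalExt hΓ hz₀).differentiableAt (by simp)).hasFDerivAt
  have h1 : HasFDerivAt (expansion Γ ν v v1 v2) _ z₀ :=
    ((hD hv).add (hd.smul (hD hv1))).add ((hd.pow 2).smul (hD hv2))
  rw [h1.fderiv]
  simp [signedDist_of_mem hz₀, normalExt_of_mem v1 hz₀, fderiv_signedDist_of_mem hΓ hz₀]

theorem fderiv_expansion_component (hΓ : IsMovingClosedSurface T Γ ν V)
    (hz₀ : z₀ ∈ spaceTimeSurface T Γ) (hv : SmoothOnSurface T Γ v)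
    (hv1 : SmoothOnSurface T Γ v1) (hv2 : SmoothOnSurface T Γ v2) (j : Fin 3) (h : E3) (k : ℝ) :
    fderiv ℝ (fun w => expansion Γ ν v v1 v2 w j) z₀ (h, k) =
      fderiv ℝ (normalExt Γ fun w => v w j) z₀ (h, k) +
      (inner ℝ (ν z₀) h - V z₀ * k) * v1 z₀ j := by
  rw [fderiv_component ((contDiffAt_expansion hΓ hz₀ hv hv1 hv2).differentiableAt (by simp)),
    fderiv_expansion hΓ hz₀ hv hv1 hv2]
  change _ = fderiv ℝ (fun w => normalExt Γ v w j) z₀ (h, k) + _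
  rw [fderiv_component ((hv.contDiffAt_normalExt hΓ hz₀).differentiableAt (by simp))]
  simp

end Expansion

/-! ### Strain rates -/

theorem strain_apply (f : E3 × ℝ → E3) (z : E3 × ℝ) (a b : Fin 3) :
    strain f z a b = (1 / 2 : ℝ) * (dx a (fun w => f w b) z + dx b (fun w => f w a) z) := by
  simp [strain, gradMat]

theorem strain_comm (f : E3 × ℝ → E3) (z : E3 × ℝ) (a b : Fin 3) :
    strain f z a b = strain f z b a := by
  rw [strain_apply, strain_apply, add_comm]

theorem sum_mul_strain_mulVec (f : E3 × ℝ → E3) (z : E3 × ℝ) (n : E3) :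
    ∑ a, n a * (strain f z *ᵥ n.ofLp) a = ∑ b, n b * fderiv ℝ (fun w => f w b) z (n, 0) := by
  have h : ∀ b, fderiv ℝ (fun w => f w b) z (n, 0) = ∑ a, n a * dx a (fun w => f w b) z :=
    fun b => by rw [map_spatial_eq_sum]; rfl
  simp only [h, Matrix.mulVec, dotProduct, strain_apply, Fin.sum_univ_three]
  ring

theorem contDiffAt_dx {f : E3 × ℝ → ℝ} {z : E3 × ℝ} (hf : ContDiffAt ℝ ∞ f z) (i : Fin 3) :
    ContDiffAt ℝ ∞ (dx i f) z :=
  (hf.fderiv_right (m := ∞) (by simp)).clm_apply contDiffAt_const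

theorem contDiffAt_strain {f : E3 × ℝ → E3} {z : E3 × ℝ} (hf : ContDiffAt ℝ ∞ f z)
    (a b : Fin 3) : ContDiffAt ℝ ∞ (fun w => strain f w a b) z := by
  simp only [strain_apply]
  exact contDiffAt_const.mul ((contDiffAt_dx (contDiffAt_component hf b) a).add
    (contDiffAt_dx (contDiffAt_component hf a) b))

theorem dx_dx_comm {f : E3 × ℝ → ℝ} {z : E3 × ℝ} (hf : ContDiffAt ℝ ∞ f z) (i j : Fin 3) :
    dx i (dx j f) z = dx j (dx i f) z := by
  have hd : DifferentiableAt ℝ (fderiv ℝ f) z :=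
    (hf.fderiv_right (m := ∞) (by simp)).differentiableAt (by simp)
  have key : ∀ i j : Fin 3, dx i (dx j f) z =
      fderiv ℝ (fderiv ℝ f) z (EuclideanSpace.single i 1, 0) (EuclideanSpace.single j 1, 0) := by
    intro i j
    change fderiv ℝ (fun w => fderiv ℝ f w (EuclideanSpace.single j 1, 0)) z _ = _
    rw [fderiv_clm_apply hd (differentiableAt_const _)]
    simp
  rw [key, key]
  exact hf.isSymmSndFDerivAt (by simpa using ENat.LEInfty.out) _ _

/-! ### Convergence of velocity and pressure from the remainder bounds -/

section Limits

variable {T : ℝ} {Γ : ℝ → Set E3} {z₀ : E3 × ℝ} {x : ℝ → E3}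

/-- Along points `x ε` of the thin domains converging to the surface, a family of vector fields
with remainder of order three is approximated together with its derivatives. -/
theorem isBigO_of_isRemainder {f : ℝ → E3 × ℝ → E3} {W : E3 × ℝ → E3} (ht : z₀.2 ∈ Ioo 0 T)
    (hR : IsRemainder T Γ 3 fun ε z => f ε z - W z) (hW : ContDiffAt ℝ ∞ W z₀)
    (hx : Tendsto (fun ε => (x ε, z₀.2)) (𝓝[>] 0) (𝓝 z₀))
    (hxΩ : ∀ᶠ ε in 𝓝[>] (0 : ℝ), x ε ∈ closure (thinDomain Γ ε z₀.2))
    (hf : ∀ᶠ ε in 𝓝[>] (0 : ℝ), ContDiffAt ℝ 2 (f ε) (x ε, z₀.2)) (j : Fin 3) :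
    ((fun ε => f ε (x ε, z₀.2) j - W (x ε, z₀.2) j) =O[𝓝[>] 0] fun ε => ε ^ 3) ∧
    (∀ m, (fun ε => fderiv ℝ (fun w => f ε w j) (x ε, z₀.2) m -
      fderiv ℝ (fun w => W w j) (x ε, z₀.2) m) =O[𝓝[>] 0] fun ε => ε ^ 2) ∧
    (∀ m m', (fun ε => fderiv ℝ (fun y => fderiv ℝ (fun w => f ε w j) y m') (x ε, z₀.2) m -
      fderiv ℝ (fun y => fderiv ℝ (fun w => W w j) y m') (x ε, z₀.2) m)
        =O[𝓝[>] 0] fun ε => ε ^ 1) := by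
  obtain ⟨C, hC⟩ := hR z₀.2 ht
  -- The bounds concern derivatives of the difference `f ε - W`; regularity of both terms at `x ε`
  -- is what lets these derivatives split.
  have hW2 : ∀ᶠ ε in 𝓝[>] (0 : ℝ), ContDiffAt ℝ 2 W (x ε, z₀.2) :=
    hx.eventually ((hW.of_le (m := 2) ENat.LEInfty.out).eventually (by simp))
  have habs : ∀ᶠ ε in 𝓝[>] (0 : ℝ), ∀ n : ℕ, ε ^ n = ‖ε ^ n‖ := by
    filter_upwards [self_mem_nhdsWithin] with ε hε n
    rw [Real.norm_of_nonneg (pow_nonneg (mem_Ioi.mp hε).le n)]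
  refine ⟨?_, fun m => ?_, fun m m' => ?_⟩
  · refine Asymptotics.IsBigO.of_bound C ?_
    filter_upwards [hC, hxΩ, habs] with ε h1 h2 h3
    have h4 := h1 _ h2 0 (by norm_num)
    rw [norm_iteratedFDeriv_zero] at h4
    rw [← h3]
    exact (PiLp.norm_apply_le (f ε (x ε, z₀.2) - W (x ε, z₀.2)) j).trans h4
  · refine Asymptotics.IsBigO.of_bound (C * ‖m‖) ?_
    filter_upwards [hC, hxΩ, habs, hW2, hf] with ε h1 h2 h3 h4 h5
    have h6 := h1 _ h2 1 (by norm_num)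
    have h4' := h4.of_le (m := 1) (by norm_num)
    have h5' := h5.of_le (m := 1) (by norm_num)
    rw [← h3]
    refine (norm_fderiv_sub_apply_le (contDiffAt_component h5' j)
      (contDiffAt_component h4' j) m).trans ?_
    have h7 : ‖iteratedFDeriv ℝ 1 (fun w => f ε w j - W w j) (x ε, z₀.2)‖ ≤ _ :=
      norm_iteratedFDeriv_component_le (n := 1) (f := fun w => f ε w - W w) (h5'.sub h4') j
    calc _ ≤ (C * ε ^ (3 - 1)) * ‖m‖ := by gcongr; exact h7.trans h6
      _ = _ := by ring
  · refine Asymptotics.IsBigO.of_bound (C * (‖m‖ * ‖m'‖)) ?_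
    filter_upwards [hC, hxΩ, habs, hW2, hf] with ε h1 h2 h3 h4 h5
    have h6 := h1 _ h2 2 (by norm_num)
    rw [← h3]
    refine (norm_fderiv_fderiv_sub_apply_le (contDiffAt_component h5 j)
      (contDiffAt_component h4 j) m m').trans ?_
    have h7 : ‖iteratedFDeriv ℝ 2 (fun w => f ε w j - W w j) (x ε, z₀.2)‖ ≤ _ :=
      norm_iteratedFDeriv_component_le (n := 2) (f := fun w => f ε w - W w) (h5.sub h4) j
    calc _ ≤ (C * ε ^ (3 - 2)) * (‖m‖ * ‖m'‖) := by gcongr; exact h7.trans h6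
      _ = _ := by ring

theorem tendsto_of_isBigO_sub_const {a : ℝ → ℝ} {b : ℝ} {n : ℕ} (hn : n ≠ 0)
    (h : (fun ε => a ε - b) =O[𝓝[>] (0 : ℝ)] fun ε => ε ^ n) : Tendsto a (𝓝[>] 0) (𝓝 b) := by
  have := (h.trans_tendsto (tendsto_pow_nhdsGT_zero hn)).add_const b
  simpa using this

theorem tendsto_fderiv_of_isRemainder {f : ℝ → E3 × ℝ → ℝ} {W : E3 × ℝ → ℝ}
    (hz₀ : z₀ ∈ spaceTimeSurface T Γ)
    (hR : IsRemainder T Γ 2 fun ε z => f ε z - W z) (hW : ContDiffAt ℝ ∞ W z₀)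
    (hf : ∀ᶠ ε in 𝓝[>] (0 : ℝ), ContDiffAt ℝ 1 (f ε) z₀) (m : E3 × ℝ) :
    Tendsto (fun ε => fderiv ℝ (f ε) z₀ m) (𝓝[>] 0) (𝓝 (fderiv ℝ W z₀ m)) := by
  obtain ⟨C, hC⟩ := hR z₀.2 hz₀.1
  refine tendsto_of_isBigO_sub_const one_ne_zero (Asymptotics.IsBigO.of_bound (C * ‖m‖) ?_)
  filter_upwards [hC, hf, self_mem_nhdsWithin] with ε h1 h2 hε
  have h3 := h1 _ (subset_closure (mem_thinDomain hε hz₀)) 1 (by norm_num)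
  rw [Real.norm_of_nonneg (pow_nonneg (mem_Ioi.mp hε).le 1)]
  refine (norm_fderiv_sub_apply_le h2 (hW.of_le ENat.LEInfty.out) m).trans ?_
  calc _ ≤ (C * ε ^ (2 - 1)) * ‖m‖ := by gcongr
    _ = _ := by ring

end Limits

/-! ### Consequences of the boundary conditions for the expansion -/

section ThinLimit

variable {μ₀ T : ℝ} {Γ : ℝ → Set E3} {ν : E3 × ℝ → E3} {V : E3 × ℝ → ℝ} {z₀ : E3 × ℝ}
  {u : ℝ → E3 × ℝ → E3} {p : ℝ → E3 × ℝ → ℝ} {v v1 v2 : E3 × ℝ → E3}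

/-- The boundary points `y + ε ν` of the thin domains approximate the expansion. -/
theorem isBigO_normalLine (hΓ : IsMovingClosedSurface T Γ ν V)
    (hNS : ∀ᶠ ε in 𝓝[>] (0 : ℝ), IsNavierStokesSolution μ₀ T (thinDomain Γ ε) (u ε) (p ε))
    (hv : SmoothOnSurface T Γ v) (hv1 : SmoothOnSurface T Γ v1) (hv2 : SmoothOnSurface T Γ v2)
    (hu : IsRemainder T Γ 3 fun ε z => u ε z - expansion Γ ν v v1 v2 z)
    (hz₀ : z₀ ∈ spaceTimeSurface T Γ) (j : Fin 3) :
    ((fun ε => u ε (z₀.1 + ε • ν z₀, z₀.2) j - expansion Γ ν v v1 v2 (z₀.1 + ε • ν z₀, z₀.2) j)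
      =O[𝓝[>] 0] fun ε => ε ^ 3) ∧
    ∀ i, (fun ε => dx i (fun w => u ε w j) (z₀.1 + ε • ν z₀, z₀.2) -
      dx i (fun w => expansion Γ ν v v1 v2 w j) (z₀.1 + ε • ν z₀, z₀.2))
        =O[𝓝[>] 0] fun ε => ε ^ 2 := by
  have hcl : ∀ᶠ ε in 𝓝[>] (0 : ℝ), z₀.1 + ε • ν z₀ ∈ closure (thinDomain Γ ε z₀.2) := by
    filter_upwards [eventually_hasOutwardNormal hΓ hz₀] with ε hε
      using frontier_subset_closure hε.1
  have hC : ∀ᶠ ε in 𝓝[>] (0 : ℝ), ContDiffAt ℝ 2 (u ε) (z₀.1 + ε • ν z₀, z₀.2) := by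
    filter_upwards [hcl, hNS] with ε h1 h2 using h2.contDiffAt_velocity _ hz₀.1 _ h1
  have h := isBigO_of_isRemainder hz₀.1 hu (contDiffAt_expansion hΓ hz₀ hv hv1 hv2)
    ((tendsto_normalLine z₀ (ν z₀)).mono_left nhdsWithin_le_nhds) hcl hC j
  exact ⟨h.1, fun i => h.2.1 _⟩

theorem inner_eq_sum (a b : E3) : inner ℝ a b = ∑ i, b i * a i := by
  simp [PiLp.inner_apply]

/-- At `y + εν` impermeability reads `u · ν(y) = V(y)`, while the expansion is a quadratic
polynomial in `ε`. An `O(ε³)` error annihilates all three coefficients of its normal component minus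
`V`. -/
theorem inner_normal_eq (hΓ : IsMovingClosedSurface T Γ ν V)
    (hNS : ∀ᶠ ε in 𝓝[>] (0 : ℝ), IsNavierStokesSolution μ₀ T (thinDomain Γ ε) (u ε) (p ε))
    (hv : SmoothOnSurface T Γ v) (hv1 : SmoothOnSurface T Γ v1) (hv2 : SmoothOnSurface T Γ v2)
    (hu : IsRemainder T Γ 3 fun ε z => u ε z - expansion Γ ν v v1 v2 z)
    (hz₀ : z₀ ∈ spaceTimeSurface T Γ) :
    inner ℝ (v z₀) (ν z₀) = V z₀ ∧ inner ℝ (v1 z₀) (ν z₀) = 0 ∧ inner ℝ (v2 z₀) (ν z₀) = 0 := by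
  have h1 : (fun ε => ∑ j, -ν z₀ j * (u ε (z₀.1 + ε • ν z₀, z₀.2) j -
      expansion Γ ν v v1 v2 (z₀.1 + ε • ν z₀, z₀.2) j)) =O[𝓝[>] (0 : ℝ)] fun ε => ε ^ 3 :=
    Asymptotics.IsBigO.fun_sum fun j _ =>
      (isBigO_normalLine hΓ hNS hv hv1 hv2 hu hz₀ j).1.const_mul_left _
  have h2 : (fun ε => (inner ℝ (v z₀) (ν z₀) - V z₀) +
      ε * (inner ℝ (v1 z₀) (ν z₀) + ε * inner ℝ (v2 z₀) (ν z₀)))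
        =O[𝓝[>] (0 : ℝ)] fun ε => ε ^ 3 := by
    refine h1.congr' ?_ EventuallyEq.rfl
    filter_upwards [hNS, eventually_hasOutwardNormal hΓ hz₀,
      (eventually_expansion_normalLine hΓ hz₀ v v1 v2).filter_mono nhdsWithin_le_nhds]
      with ε h3 h4 h5
    have h6 := h3.boundary_normal _ hz₀.1 _ h4.1 _ _ h4.2
    rw [h5, ← h6]
    simp only [inner_eq_sum, Fin.sum_univ_three, PiLp.add_apply, PiLp.smul_apply, smul_eq_mul]
    ring
  obtain ⟨ha, hb, hc⟩ := coeff_eq_zero_of_isBigO h2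
  exact ⟨sub_eq_zero.mp ha, hb, hc⟩

/-- The normal component of the normal derivative of the expansion vanishes. -/
theorem eventually_sum_mul_strain_normal (hΓ : IsMovingClosedSurface T Γ ν V)
    (hNS : ∀ᶠ ε in 𝓝[>] (0 : ℝ), IsNavierStokesSolution μ₀ T (thinDomain Γ ε) (u ε) (p ε))
    (hv : SmoothOnSurface T Γ v) (hv1 : SmoothOnSurface T Γ v1) (hv2 : SmoothOnSurface T Γ v2)
    (hu : IsRemainder T Γ 3 fun ε z => u ε z - expansion Γ ν v v1 v2 z)
    (hz₀ : z₀ ∈ spaceTimeSurface T Γ) :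
    ∀ᶠ r in 𝓝 (0 : ℝ), ∑ a, ν z₀ a *
      (strain (expansion Γ ν v v1 v2) (z₀.1 + r • ν z₀, z₀.2) *ᵥ (ν z₀).ofLp) a = 0 := by
  obtain ⟨ha, hb, hc⟩ := inner_normal_eq hΓ hNS hv hv1 hv2 hu hz₀
  set W := expansion Γ ν v v1 v2 with hW
  have hWC : ∀ᶠ z in 𝓝 z₀, ContDiffAt ℝ 2 W z :=
    ((contDiffAt_expansion hΓ hz₀ hv hv1 hv2).of_le (m := 2) ENat.LEInfty.out).eventually
      (by simp)
  filter_upwards [(eventually_expansion_normalLine hΓ hz₀ v v1 v2).eventually_nhds,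
    (tendsto_normalLine z₀ (ν z₀)).eventually hWC] with r h1 h2
  rw [sum_mul_strain_mulVec]
  have hline : HasDerivAt (fun s : ℝ => (z₀.1 + s • ν z₀, z₀.2)) (ν z₀, (0 : ℝ)) r := by
    have h3 : HasDerivAt (fun s : ℝ => z₀.1 + s • ν z₀) (ν z₀) r := by
      simpa using ((hasDerivAt_id r).smul_const (ν z₀)).const_add z₀.1
    exact h3.prodMk (hasDerivAt_const r z₀.2)
  have h4 : HasDerivAt (fun s : ℝ => ∑ b, ν z₀ b * W (z₀.1 + s • ν z₀, z₀.2) b)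
      (∑ b, ν z₀ b * fderiv ℝ (fun w => W w b) (z₀.1 + r • ν z₀, z₀.2) (ν z₀, 0)) r := by
    refine HasDerivAt.fun_sum fun b _ => HasDerivAt.const_mul _ ?_
    have h5 : HasFDerivAt (fun w => W w b) _ (z₀.1 + r • ν z₀, z₀.2) :=
      ((contDiffAt_component h2 b).differentiableAt (by simp)).hasFDerivAt
    exact HasFDerivAt.comp_hasDerivAt (f := fun s : ℝ => (z₀.1 + s • ν z₀, z₀.2)) r h5 hline
  -- Because `v·ν = V` and `v¹·ν = v²·ν = 0`, the normal component of `W` is constant along the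
  -- line.
  have h5 : HasDerivAt (fun s : ℝ => ∑ b, ν z₀ b * W (z₀.1 + s • ν z₀, z₀.2) b) 0 r := by
    refine (hasDerivAt_const r (V z₀)).congr_of_eventuallyEq ?_
    filter_upwards [h1] with s hs
    rw [← inner_eq_sum, hW, hs, inner_add_left, inner_add_left, real_inner_smul_left,
      real_inner_smul_left, ha, hb, hc]
    ring
  exact h4.unique h5

/-- The strain rate of the expansion in the normal direction vanishes on the surface up to second
order along the normal. -/
theorem strain_normal_eq_zero (hΓ : IsMovingClosedSurface T Γ ν V)
    (hNS : ∀ᶠ ε in 𝓝[>] (0 : ℝ), IsNavierStokesSolution μ₀ T (thinDomain Γ ε) (u ε) (p ε))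
    (hv : SmoothOnSurface T Γ v) (hv1 : SmoothOnSurface T Γ v1) (hv2 : SmoothOnSurface T Γ v2)
    (hu : IsRemainder T Γ 3 fun ε z => u ε z - expansion Γ ν v v1 v2 z)
    (hz₀ : z₀ ∈ spaceTimeSurface T Γ) (a : Fin 3) :
    (∑ b, ν z₀ b * strain (expansion Γ ν v v1 v2) z₀ a b = 0) ∧
      ∑ b, ν z₀ b * fderiv ℝ (fun w => strain (expansion Γ ν v v1 v2) w a b) z₀ (ν z₀, 0) = 0 := by
  set W := expansion Γ ν v v1 v2 with hW
  set c : ℝ → E3 × ℝ := fun r => (z₀.1 + r • ν z₀, z₀.2) with hc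
  have hc0 : c 0 = z₀ := by simp [hc]
  have hstrain : ∀ a b, (fun ε => strain (u ε) (c ε) a b - strain W (c ε) a b)
      =O[𝓝[>] (0 : ℝ)] fun ε => ε ^ 2 := by
    intro a b
    have h := (((isBigO_normalLine hΓ hNS hv hv1 hv2 hu hz₀ b).2 a).add
      ((isBigO_normalLine hΓ hNS hv hv1 hv2 hu hz₀ a).2 b)).const_mul_left (1 / 2 : ℝ)
    refine h.congr_left fun ε => ?_
    simp only [strain_apply, hc]
    ring
  have hvec : ∀ a, (fun ε => ∑ b, ν z₀ b * (strain (u ε) (c ε) a b - strain W (c ε) a b))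
      =O[𝓝[>] (0 : ℝ)] fun ε => ε ^ 2 := fun a =>
    Asymptotics.IsBigO.fun_sum fun b _ => (hstrain a b).const_mul_left _
  have hbig : (fun ε => ∑ b, ν z₀ b * strain W (c ε) a b) =O[𝓝[>] (0 : ℝ)] fun ε => ε ^ 2 := by
    -- With `E = D(u) - D(W)` this is the component of `-P E ν`. Since `P D(u)ν = 0` and `ν · D(W)ν
    -- = 0`, it equals that of `D(W)ν`.
    have h : (fun ε => ν z₀ a *
        (∑ d, ν z₀ d * ∑ b, ν z₀ b * (strain (u ε) (c ε) d b - strain W (c ε) d b)) -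
        ∑ b, ν z₀ b * (strain (u ε) (c ε) a b - strain W (c ε) a b))
        =O[𝓝[>] (0 : ℝ)] fun ε => ε ^ 2 :=
      ((Asymptotics.IsBigO.fun_sum fun d _ => (hvec d).const_mul_left _).const_mul_left _).sub (hvec a)
    refine h.congr' ?_ EventuallyEq.rfl
    filter_upwards [hNS, eventually_hasOutwardNormal hΓ hz₀, (eventually_sum_mul_strain_normal hΓ
      hNS hv hv1 hv2 hu hz₀).filter_mono nhdsWithin_le_nhds] with ε h1 h2 h3
    have h4 := congrFun (h1.boundary_tangential _ hz₀.1 _ h2.1 _ _ h2.2) a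
    rw [Matrix.sub_mulVec, Matrix.one_mulVec, Matrix.vecMulVec_mulVec] at h4
    change (strain (u ε) (c ε) *ᵥ (ν z₀).ofLp) a - _ = 0 at h4
    simp only [Matrix.mulVec, dotProduct, Fin.sum_univ_three, Pi.smul_apply,
      MulOpposite.smul_eq_mul_unop, MulOpposite.unop_op] at h3 h4 ⊢
    linear_combination -h4 - ν z₀ a * h3
  have hline : HasDerivAt c (ν z₀, (0 : ℝ)) 0 := by
    have h3 : HasDerivAt (fun s : ℝ => z₀.1 + s • ν z₀) (ν z₀) 0 := by
      simpa using ((hasDerivAt_id (0 : ℝ)).smul_const (ν z₀)).const_add z₀.1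
    exact h3.prodMk (hasDerivAt_const 0 z₀.2)
  have hder : HasDerivAt (fun s => ∑ b, ν z₀ b * strain W (c s) a b)
      (∑ b, ν z₀ b * fderiv ℝ (fun w => strain W w a b) z₀ (ν z₀, 0)) 0 := by
    refine HasDerivAt.fun_sum fun b _ => HasDerivAt.const_mul _ ?_
    have h5 : HasFDerivAt (fun w => strain W w a b) (fderiv ℝ (fun w => strain W w a b) z₀)
        (c 0) := by
      rw [hc0]
      exact ((contDiffAt_strain (contDiffAt_expansion hΓ hz₀ hv hv1 hv2) a b).differentiableAt
        (by simp)).hasFDerivAt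
    exact HasFDerivAt.comp_hasDerivAt (f := c) 0 h5 hline
  have h := eq_zero_of_isBigO_sq hder hbig
  rw [hc0] at h
  exact h

end ThinLimit

/-! ### The surface strain rate and its divergence -/

section SurfaceStrain

variable {μ₀ T : ℝ} {Γ : ℝ → Set E3} {ν : E3 × ℝ → E3} {V : E3 × ℝ → ℝ} {z₀ : E3 × ℝ}
  {u : ℝ → E3 × ℝ → E3} {p : ℝ → E3 × ℝ → ℝ} {v v1 v2 : E3 × ℝ → E3}

theorem proj_transpose (ν : E3 × ℝ → E3) (z : E3 × ℝ) : (proj ν z)ᵀ = proj ν z := by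
  simp [proj, Matrix.transpose_vecMulVec]

theorem dotProduct_normal (hΓ : IsMovingClosedSurface T Γ ν V)
    (hz₀ : z₀ ∈ spaceTimeSurface T Γ) : (ν z₀).ofLp ⬝ᵥ (ν z₀).ofLp = 1 := by
  have h := real_inner_self_eq_norm_sq (ν z₀)
  rw [norm_normal hΓ hz₀, inner_eq_sum, one_pow] at h
  exact h

theorem proj_mulVec_normal (hΓ : IsMovingClosedSurface T Γ ν V)
    (hz₀ : z₀ ∈ spaceTimeSurface T Γ) : proj ν z₀ *ᵥ (ν z₀).ofLp = 0 := by
  rw [proj, Matrix.sub_mulVec, Matrix.one_mulVec, Matrix.vecMulVec_mulVec,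
    dotProduct_normal hΓ hz₀]
  simp

theorem proj_mul_proj (hΓ : IsMovingClosedSurface T Γ ν V)
    (hz₀ : z₀ ∈ spaceTimeSurface T Γ) : proj ν z₀ * proj ν z₀ = proj ν z₀ := by
  conv_lhs => rw [proj, mul_sub, mul_one, Matrix.mul_vecMulVec]
  change proj ν z₀ - Matrix.vecMulVec (proj ν z₀ *ᵥ (ν z₀).ofLp) _ = _
  rw [proj_mulVec_normal hΓ hz₀, Matrix.zero_vecMulVec, sub_zero]

theorem surfGradMat_eq (Γ : ℝ → Set E3) (ν v : E3 × ℝ → E3) (z : E3 × ℝ) :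
    surfGradMat Γ ν v z = proj ν z * gradMat (normalExt Γ v) z := by
  ext i j
  rfl

theorem gradMat_expansion (hΓ : IsMovingClosedSurface T Γ ν V)
    (hz₀ : z₀ ∈ spaceTimeSurface T Γ) (hv : SmoothOnSurface T Γ v)
    (hv1 : SmoothOnSurface T Γ v1) (hv2 : SmoothOnSurface T Γ v2) :
    gradMat (expansion Γ ν v v1 v2) z₀ =
      gradMat (normalExt Γ v) z₀ + Matrix.vecMulVec (ν z₀).ofLp (v1 z₀).ofLp := by
  ext i j
  have h := fderiv_expansion_component hΓ hz₀ hv hv1 hv2 j (EuclideanSpace.single i 1) 0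
  rw [EuclideanSpace.inner_single_right] at h
  simp only [gradMat, Matrix.of_apply, Matrix.add_apply, Matrix.vecMulVec_apply, dx]
  rw [h]
  simp
  rfl

/-- On the surface, the strain rate of the expansion is the projected tangential strain rate. -/
theorem strain_expansion_eq (hΓ : IsMovingClosedSurface T Γ ν V)
    (hNS : ∀ᶠ ε in 𝓝[>] (0 : ℝ), IsNavierStokesSolution μ₀ T (thinDomain Γ ε) (u ε) (p ε))
    (hv : SmoothOnSurface T Γ v) (hv1 : SmoothOnSurface T Γ v1) (hv2 : SmoothOnSurface T Γ v2)
    (hu : IsRemainder T Γ 3 fun ε z => u ε z - expansion Γ ν v v1 v2 z)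
    (hz₀ : z₀ ∈ spaceTimeSurface T Γ) :
    strain (expansion Γ ν v v1 v2) z₀ = proj ν z₀ * tanStrain Γ ν v z₀ * proj ν z₀ := by
  set D := strain (expansion Γ ν v v1 v2) z₀ with hD
  set P := proj ν z₀ with hP
  set A := gradMat (normalExt Γ v) z₀ with hA
  have hPP : P * P = P := proj_mul_proj hΓ hz₀
  have hPt : Pᵀ = P := proj_transpose ν z₀
  have hPν : P *ᵥ (ν z₀).ofLp = 0 := proj_mulVec_normal hΓ hz₀
  have hνP : (ν z₀).ofLp ᵥ* P = 0 := by rw [← hPt, Matrix.vecMul_transpose, hPν]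
  have hDν : D *ᵥ (ν z₀).ofLp = 0 := by
    ext a
    have h := (strain_normal_eq_zero hΓ hNS hv hv1 hv2 hu hz₀ a).1
    simp only [Matrix.mulVec, dotProduct, Pi.zero_apply]
    rw [← h]
    exact Finset.sum_congr rfl fun b _ => mul_comm _ _
  have hνD : (ν z₀).ofLp ᵥ* D = 0 := by
    have hDt : Dᵀ = D := by
      ext a b
      exact strain_comm _ _ _ _
    rw [← hDt, Matrix.vecMul_transpose, hDν]
  have hPD : P * D = D := by
    rw [hP, proj, sub_mul, one_mul, Matrix.vecMulVec_mul, hνD, Matrix.vecMulVec_zero, sub_zero]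
  have hDP : D * P = D := by
    rw [hP, proj, mul_sub, mul_one, Matrix.mul_vecMulVec, hDν, Matrix.zero_vecMulVec, sub_zero]
  -- `D ν = 0` and the symmetry of `D` make it purely tangential. In `h2` the terms `ν ⊗ v¹` and `v¹
  -- ⊗ ν` are then killed by a factor `P`.
  have h1 : D = P * D * P := by rw [hPD, hDP]
  have h2 : P * D * P = (1 / 2 : ℝ) • (P * A * P + P * Aᵀ * P) := by
    rw [hD, strain, gradMat_expansion hΓ hz₀ hv hv1 hv2, ← hA]
    simp only [Matrix.transpose_add, Matrix.transpose_vecMulVec, mul_add, add_mul,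
      Matrix.mul_smul, Matrix.smul_mul, Matrix.mul_vecMulVec, Matrix.vecMulVec_mul, hPν, hνP,
      Matrix.zero_vecMulVec, Matrix.vecMulVec_zero, add_zero]
  have h3 : P * tanStrain Γ ν v z₀ * P = (1 / 2 : ℝ) • (P * A * P + P * Aᵀ * P) := by
    rw [tanStrain, surfGradMat_eq, ← hA, ← hP]
    simp only [Matrix.transpose_mul, hPt, mul_add, add_mul, Matrix.mul_smul, Matrix.smul_mul]
    congr 2
    · rw [← Matrix.mul_assoc, hPP]
    · rw [Matrix.mul_assoc, Matrix.mul_assoc, hPP, Matrix.mul_assoc]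
  rw [h1, h2, h3]

theorem dx_strain {f : E3 × ℝ → E3} {z : E3 × ℝ} (hf : ContDiffAt ℝ ∞ f z) (i a b : Fin 3) :
    dx i (fun w => strain f w a b) z =
      (1 / 2 : ℝ) * (dx i (dx a fun w => f w b) z + dx i (dx b fun w => f w a) z) := by
  have h : ∀ a b, HasFDerivAt (dx a fun w => f w b) (fderiv ℝ (dx a fun w => f w b) z) z :=
    fun a b => ((contDiffAt_dx (contDiffAt_component hf b) a).differentiableAt
      (by simp)).hasFDerivAt
  simp only [strain_apply]
  have h2 : HasFDerivAt (fun w => (1 / 2 : ℝ) *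
      (dx a (fun w => f w b) w + dx b (fun w => f w a) w)) _ z :=
    ((h a b).add (h b a)).const_mul (1 / 2 : ℝ)
  rw [dx, h2.fderiv]
  simp [dx, mul_add]

/-- `D(W)` extends `P Dᵗᵃⁿ(v) P` off the surface, so `div_Γ` is its full divergence minus `∑ νᵢ ∂_ν
D(W)ᵢⱼ`. The latter is zero by `strain_normal_eq_zero`, and the former is `½ (ΔW + ∇ div W)`. -/
theorem surfDivMat_eq (hΓ : IsMovingClosedSurface T Γ ν V)
    (hNS : ∀ᶠ ε in 𝓝[>] (0 : ℝ), IsNavierStokesSolution μ₀ T (thinDomain Γ ε) (u ε) (p ε))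
    (hv : SmoothOnSurface T Γ v) (hv1 : SmoothOnSurface T Γ v1) (hv2 : SmoothOnSurface T Γ v2)
    (hu : IsRemainder T Γ 3 fun ε z => u ε z - expansion Γ ν v v1 v2 z)
    (hz₀ : z₀ ∈ spaceTimeSurface T Γ) (j : Fin 3) :
    surfDivMat Γ ν (fun w => proj ν w * tanStrain Γ ν v w * proj ν w) j z₀ =
      (1 / 2 : ℝ) * (∑ i, dx i (dx i fun w => expansion Γ ν v v1 v2 w j) z₀ +
        ∑ i, dx j (dx i fun w => expansion Γ ν v v1 v2 w i) z₀) := by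
  set W := expansion Γ ν v v1 v2 with hW
  have hWC : ContDiffAt ℝ ∞ W z₀ := contDiffAt_expansion hΓ hz₀ hv hv1 hv2
  have h1 : ∀ i, tanD Γ ν i (fun w => (proj ν w * tanStrain Γ ν v w * proj ν w) i j) z₀ =
      dx i (fun w => strain W w i j) z₀ -
        ν z₀ i * fderiv ℝ (fun w => strain W w i j) z₀ (ν z₀, 0) := by
    intro i
    refine tanD_eq hΓ hz₀ ((contDiffAt_strain hWC i j).differentiableAt (by simp)) ?_ i
    filter_upwards [self_mem_nhdsWithin] with w hw
    rw [hW, strain_expansion_eq hΓ hNS hv hv1 hv2 hu hw]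
  have h2 : ∑ i, ν z₀ i * fderiv ℝ (fun w => strain W w i j) z₀ (ν z₀, 0) = 0 := by
    simp only [fun w i => strain_comm W w i j]
    exact (strain_normal_eq_zero hΓ hNS hv hv1 hv2 hu hz₀ j).2
  rw [surfDivMat, Finset.sum_congr rfl fun i _ => h1 i, Finset.sum_sub_distrib, h2, sub_zero]
  simp only [dx_strain hWC]
  rw [← Finset.mul_sum, Finset.sum_add_distrib]
  congr 2
  exact Finset.sum_congr rfl fun i _ => dx_dx_comm (contDiffAt_component hWC i) i j

end SurfaceStrain

/-! ### Limit of the Navier-Stokes equations on the surface -/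

section Equations

variable {μ₀ T : ℝ} {Γ : ℝ → Set E3} {ν : E3 × ℝ → E3} {V : E3 × ℝ → ℝ} {z₀ : E3 × ℝ}
  {u : ℝ → E3 × ℝ → E3} {p : ℝ → E3 × ℝ → ℝ} {v v1 v2 : E3 × ℝ → E3}

/-- At a point of the surface, the velocities converge with their derivatives. -/
theorem tendsto_velocity (hΓ : IsMovingClosedSurface T Γ ν V)
    (hNS : ∀ᶠ ε in 𝓝[>] (0 : ℝ), IsNavierStokesSolution μ₀ T (thinDomain Γ ε) (u ε) (p ε))
    (hv : SmoothOnSurface T Γ v) (hv1 : SmoothOnSurface T Γ v1) (hv2 : SmoothOnSurface T Γ v2)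
    (hu : IsRemainder T Γ 3 fun ε z => u ε z - expansion Γ ν v v1 v2 z)
    (hz₀ : z₀ ∈ spaceTimeSurface T Γ) (j : Fin 3) :
    Tendsto (fun ε => u ε z₀ j) (𝓝[>] 0) (𝓝 (v z₀ j)) ∧
    (∀ m, Tendsto (fun ε => fderiv ℝ (fun w => u ε w j) z₀ m) (𝓝[>] 0)
      (𝓝 (fderiv ℝ (fun w => expansion Γ ν v v1 v2 w j) z₀ m))) ∧
    ∀ i k, Tendsto (fun ε => dx i (dx k fun w => u ε w j) z₀) (𝓝[>] 0)
      (𝓝 (dx i (dx k fun w => expansion Γ ν v v1 v2 w j) z₀)) := by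
  have hcl : ∀ᶠ ε in 𝓝[>] (0 : ℝ), z₀.1 ∈ closure (thinDomain Γ ε z₀.2) := by
    filter_upwards [self_mem_nhdsWithin] with ε hε using subset_closure (mem_thinDomain hε hz₀)
  have hC : ∀ᶠ ε in 𝓝[>] (0 : ℝ), ContDiffAt ℝ 2 (u ε) (z₀.1, z₀.2) := by
    filter_upwards [hcl, hNS] with ε h1 h2 using h2.contDiffAt_velocity _ hz₀.1 _ h1
  obtain ⟨h0, h1, h2⟩ := isBigO_of_isRemainder (x := fun _ => z₀.1) hz₀.1 hu
    (contDiffAt_expansion hΓ hz₀ hv hv1 hv2) tendsto_const_nhds hcl hC j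
  refine ⟨?_, fun m => tendsto_of_isBigO_sub_const two_ne_zero (h1 m),
    fun i k => tendsto_of_isBigO_sub_const one_ne_zero (h2 _ _)⟩
  have h3 := tendsto_of_isBigO_sub_const three_ne_zero h0
  rw [expansion_of_mem hz₀] at h3
  exact h3

/-- The gradient of `div u = 0` vanishes in the thin domain. The remainder of order three still
controls second derivatives, so this passes to the limit. -/
theorem sum_dx_dx_expansion_eq_zero (hΓ : IsMovingClosedSurface T Γ ν V)
    (hNS : ∀ᶠ ε in 𝓝[>] (0 : ℝ), IsNavierStokesSolution μ₀ T (thinDomain Γ ε) (u ε) (p ε))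
    (hv : SmoothOnSurface T Γ v) (hv1 : SmoothOnSurface T Γ v1) (hv2 : SmoothOnSurface T Γ v2)
    (hu : IsRemainder T Γ 3 fun ε z => u ε z - expansion Γ ν v v1 v2 z)
    (hz₀ : z₀ ∈ spaceTimeSurface T Γ) (j : Fin 3) :
    ∑ i, dx j (dx i fun w => expansion Γ ν v v1 v2 w i) z₀ = 0 := by
  have h1 : Tendsto (fun ε => ∑ i, dx j (dx i fun w => u ε w i) z₀) (𝓝[>] 0)
      (𝓝 (∑ i, dx j (dx i fun w => expansion Γ ν v v1 v2 w i) z₀)) :=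
    tendsto_finsetSum _ fun i _ => (tendsto_velocity hΓ hNS hv hv1 hv2 hu hz₀ i).2.2 j i
  refine tendsto_nhds_unique h1 (tendsto_const_nhds.congr' ?_)
  filter_upwards [hNS, self_mem_nhdsWithin] with ε hS hε
  have hmem := mem_thinDomain hε hz₀
  have hC : ContDiffAt ℝ 2 (u ε) z₀ := hS.contDiffAt_velocity _ hz₀.1 _ (subset_closure hmem)
  have hd : ∀ i, DifferentiableAt ℝ (dx i fun w => u ε w i) z₀ := fun i =>
    (((contDiffAt_component hC i).fderiv_right (m := 1) (by norm_num)).differentiableAt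
      (by simp)).clm_apply (differentiableAt_const _)
  have h2 : HasFDerivAt (fun w => ∑ i, dx i (fun w => u ε w i) w)
      (∑ i, fderiv ℝ (dx i fun w => u ε w i) z₀) z₀ :=
    HasFDerivAt.fun_sum fun i _ => (hd i).hasFDerivAt
  -- The slice of the thin domain at the fixed time is open, so a spatial line through the point
  -- stays inside it for small `s` and suffices for `∂ⱼ`.
  have hline : HasDerivAt (fun s : ℝ => (z₀.1 + s • EuclideanSpace.single j (1 : ℝ), z₀.2))
      (EuclideanSpace.single j (1 : ℝ), (0 : ℝ)) 0 := by
    have h3 : HasDerivAt (fun s : ℝ => z₀.1 + s • EuclideanSpace.single j (1 : ℝ))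
        (EuclideanSpace.single j (1 : ℝ)) 0 := by
      simpa using ((hasDerivAt_id (0 : ℝ)).smul_const
        (EuclideanSpace.single j (1 : ℝ))).const_add z₀.1
    exact h3.prodMk (hasDerivAt_const 0 z₀.2)
  have h2' : HasFDerivAt (fun w => ∑ i, dx i (fun w => u ε w i) w)
      (∑ i, fderiv ℝ (dx i fun w => u ε w i) z₀)
      (z₀.1 + (0 : ℝ) • EuclideanSpace.single j (1 : ℝ), z₀.2) := by simpa using h2
  have h3 := HasFDerivAt.comp_hasDerivAt
    (f := fun s : ℝ => (z₀.1 + s • EuclideanSpace.single j (1 : ℝ), z₀.2)) 0 h2' hline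
  have h4 : HasDerivAt ((fun w => ∑ i, dx i (fun w => u ε w i) w) ∘
      fun s : ℝ => (z₀.1 + s • EuclideanSpace.single j (1 : ℝ), z₀.2)) 0 0 := by
    refine (hasDerivAt_const (0 : ℝ) (0 : ℝ)).congr_of_eventuallyEq ?_
    have h5 : Tendsto (fun s : ℝ => z₀.1 + s • EuclideanSpace.single j (1 : ℝ)) (𝓝 0)
        (𝓝 z₀.1) := by
      have : Continuous fun s : ℝ => z₀.1 + s • EuclideanSpace.single j (1 : ℝ) := by fun_prop
      simpa using this.tendsto 0
    filter_upwards [h5.eventually (Metric.isOpen_thickening.mem_nhds hmem)] with s hs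
    exact hS.divergence_free _ hz₀.1 _ hs
  have h5 := h4.unique h3
  rw [h5, sum_apply]
  rfl

/-- On the surface `div W = div_Γ v + v¹·ν`, and the boundary condition has already given `v¹·ν =
0`. -/
theorem surfDiv_eq_zero (hΓ : IsMovingClosedSurface T Γ ν V)
    (hNS : ∀ᶠ ε in 𝓝[>] (0 : ℝ), IsNavierStokesSolution μ₀ T (thinDomain Γ ε) (u ε) (p ε))
    (hv : SmoothOnSurface T Γ v) (hv1 : SmoothOnSurface T Γ v1) (hv2 : SmoothOnSurface T Γ v2)
    (hu : IsRemainder T Γ 3 fun ε z => u ε z - expansion Γ ν v v1 v2 z)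
    (hz₀ : z₀ ∈ spaceTimeSurface T Γ) : surfDiv Γ ν v z₀ = 0 := by
  have h1 : Tendsto (fun ε => ∑ i, dx i (fun w => u ε w i) z₀) (𝓝[>] 0)
      (𝓝 (∑ i, dx i (fun w => expansion Γ ν v v1 v2 w i) z₀)) :=
    tendsto_finsetSum _ fun i _ => (tendsto_velocity hΓ hNS hv hv1 hv2 hu hz₀ i).2.1 _
  have h2 : ∑ i, dx i (fun w => expansion Γ ν v v1 v2 w i) z₀ = 0 := by
    refine tendsto_nhds_unique h1 (tendsto_const_nhds.congr' ?_)
    filter_upwards [hNS, self_mem_nhdsWithin] with ε hS hε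
    exact (hS.divergence_free _ hz₀.1 _ (mem_thinDomain hε hz₀)).symm
  have h3 := (inner_normal_eq hΓ hNS hv hv1 hv2 hu hz₀).2.1
  rw [inner_eq_sum] at h3
  have h4 : ∀ i, dx i (fun w => expansion Γ ν v v1 v2 w i) z₀ =
      tanD Γ ν i (fun w => v w i) z₀ + ν z₀ i * v1 z₀ i := by
    intro i
    rw [tanD_eq_dx hΓ hz₀ (hv.apply i), dx, fderiv_expansion_component hΓ hz₀ hv hv1 hv2,
      EuclideanSpace.inner_single_right, dx]
    simp
  simp only [h4, Finset.sum_add_distrib, h3, add_zero] at h2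
  exact h2

/-- Every term of the momentum equation converges at a point of the surface. The Laplacian becomes
`ΔW`, which is twice the surface stress divergence because `∇ div W = 0`. -/
theorem momentum_surface (hΓ : IsMovingClosedSurface T Γ ν V)
    (hNS : ∀ᶠ ε in 𝓝[>] (0 : ℝ), IsNavierStokesSolution μ₀ T (thinDomain Γ ε) (u ε) (p ε))
    (hv : SmoothOnSurface T Γ v) (hv1 : SmoothOnSurface T Γ v1) (hv2 : SmoothOnSurface T Γ v2)
    {q q1 : E3 × ℝ → ℝ} (hq : SmoothOnSurface T Γ q) (hq1 : SmoothOnSurface T Γ q1)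
    (hu : IsRemainder T Γ 3 fun ε z => u ε z - expansion Γ ν v v1 v2 z)
    (hp : IsRemainder T Γ 2 fun ε z => p ε z - (normalExt Γ q z
      + signedDist Γ ν z * normalExt Γ q1 z))
    (hz₀ : z₀ ∈ spaceTimeSurface T Γ) (j : Fin 3) :
    materialDeriv Γ v (fun w => v w j) z₀ + tanD Γ ν j q z₀ + q1 z₀ * ν z₀ j =
      2 * μ₀ * surfDivMat Γ ν (fun w => proj ν w * tanStrain Γ ν v w * proj ν w) j z₀ := by
  have hd := (hΓ.eventually_isTubePoint hz₀).1.self_of_nhds.contDiffAt_signedDist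
  have hqC := hq.contDiffAt_normalExt hΓ hz₀
  have hq1C := hq1.contDiffAt_normalExt hΓ hz₀
  have hpC : ∀ᶠ ε in 𝓝[>] (0 : ℝ), ContDiffAt ℝ 1 (p ε) z₀ := by
    filter_upwards [hNS, self_mem_nhdsWithin] with ε hS hε
    exact hS.contDiffAt_pressure _ hz₀.1 _ (subset_closure (mem_thinDomain hε hz₀))
  have hpt := tendsto_fderiv_of_isRemainder hz₀ hp (hqC.add (hd.mul hq1C)) hpC
    (EuclideanSpace.single j 1, 0)
  have hut := fun j => tendsto_velocity hΓ hNS hv hv1 hv2 hu hz₀ j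
  have hlhs := (((hut j).2.1 (0, 1)).add (tendsto_finsetSum Finset.univ fun i _ =>
    (hut i).1.mul ((hut j).2.1 (EuclideanSpace.single i 1, 0)))).add hpt
  have hrhs := (tendsto_finsetSum Finset.univ fun i _ => (hut j).2.2 i i).const_mul μ₀
  have hlim := tendsto_nhds_unique_of_eventuallyEq hlhs hrhs (by
    filter_upwards [hNS, self_mem_nhdsWithin] with ε hS hε
    exact hS.momentum _ hz₀.1 _ (mem_thinDomain hε hz₀) j)
  -- At `d = 0` the gradient of `d q̄¹` is `q¹ ν`, the normal pressure term.
  have hpress : fderiv ℝ (fun z => normalExt Γ q z + signedDist Γ ν z * normalExt Γ q1 z) z₀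
      (EuclideanSpace.single j 1, 0) = tanD Γ ν j q z₀ + q1 z₀ * ν z₀ j := by
    have h : HasFDerivAt (fun z => normalExt Γ q z + signedDist Γ ν z * normalExt Γ q1 z) _ z₀ :=
      (hqC.differentiableAt (by simp)).hasFDerivAt.add
        ((hd.differentiableAt (by simp)).hasFDerivAt.mul
          (hq1C.differentiableAt (by simp)).hasFDerivAt)
    rw [h.fderiv, tanD_eq_dx hΓ hz₀ hq]
    simp [signedDist_of_mem hz₀, normalExt_of_mem q1 hz₀, fderiv_signedDist_of_mem hΓ hz₀,
      EuclideanSpace.inner_single_right, dx]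
  have hinner := (inner_normal_eq hΓ hNS hv hv1 hv2 hu hz₀).1
  rw [inner_eq_sum] at hinner
  -- Differentiating `d v̄¹` along `(v, 1)` leaves `(v·ν - V) v¹`, which vanishes since `v·ν = V`.
  have hmat : fderiv ℝ (fun w => expansion Γ ν v v1 v2 w j) z₀ (0, 1) + ∑ i, v z₀ i *
      fderiv ℝ (fun w => expansion Γ ν v v1 v2 w j) z₀ (EuclideanSpace.single i 1, 0) =
      materialDeriv Γ v (fun w => v w j) z₀ := by
    simp only [fderiv_expansion_component hΓ hz₀ hv hv1 hv2, materialDeriv, dt, dx,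
      EuclideanSpace.inner_single_right, inner_zero_right]
    simp only [Fin.sum_univ_three] at hinner ⊢
    simp
    linear_combination v1 z₀ j * hinner
  rw [hmat, hpress] at hlim
  rw [surfDivMat_eq hΓ hNS hv hv1 hv2 hu hz₀,
    sum_dx_dx_expansion_eq_zero hΓ hNS hv hv1 hv2 hu hz₀, add_assoc, hlim]
  ring

end Equations

end ThinNS

end

open ThinNS
theorem theorem4p1 (T μ₀ : ℝ) (hT : 0 < T) (hμ₀ : 0 < μ₀)
    (Γ : ℝ → Set E3) (ν : E3 × ℝ → E3) (V : E3 × ℝ → ℝ)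
    (hΓ : IsMovingClosedSurface T Γ ν V)
    (u : ℝ → E3 × ℝ → E3) (p : ℝ → E3 × ℝ → ℝ)
    (hNS : ∀ᶠ ε in 𝓝[>] (0 : ℝ), IsNavierStokesSolution μ₀ T (thinDomain Γ ε) (u ε) (p ε))
    (v v1 v2 : E3 × ℝ → E3) (q q1 : E3 × ℝ → ℝ)
    (hv : SmoothOnSurface T Γ v) (hv1 : SmoothOnSurface T Γ v1) (hv2 : SmoothOnSurface T Γ v2)
    (hq : SmoothOnSurface T Γ q) (hq1 : SmoothOnSurface T Γ q1)
    (hu : IsRemainder T Γ 3 fun ε z => u ε z - (normalExt Γ v z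
      + signedDist Γ ν z • normalExt Γ v1 z + signedDist Γ ν z ^ 2 • normalExt Γ v2 z))
    (hp : IsRemainder T Γ 2 fun ε z => p ε z - (normalExt Γ q z
      + signedDist Γ ν z * normalExt Γ q1 z)) :
    (∀ z ∈ spaceTimeSurface T Γ, inner ℝ (v z) (ν z) = V z) ∧
    (∀ z ∈ spaceTimeSurface T Γ, ∀ j : Fin 3,
      materialDeriv Γ v (fun w => v w j) z + tanD Γ ν j q z + q1 z * ν z j =
        2 * μ₀ * surfDivMat Γ ν (fun w => proj ν w * tanStrain Γ ν v w * proj ν w) j z) ∧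
    (∀ z ∈ spaceTimeSurface T Γ, surfDiv Γ ν v z = 0) := by
  have hu' : IsRemainder T Γ 3 fun ε z => u ε z - expansion Γ ν v v1 v2 z := hu
  exact ⟨fun z hz => (inner_normal_eq hΓ hNS hv hv1 hv2 hu' hz).1,
    fun z hz j => momentum_surface hΓ hNS hv hv1 hv2 hq hq1 hu' hp hz j,
    fun z hz => surfDiv_eq_zero hΓ hNS hv hv1 hv2 hu' hz⟩
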